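/- **Theorem (consistency of the varying-window random threshold).** Setting. For each $n$ we observe $Y_i=\mu_i+\varepsilon_i$, $1\le i\le n$ (the means $\mu_i=\mu_{n,i}$ may depend on $n$), where the errors $\varepsilon_i$ are i.i.d. with zero mean and a fixed, known, continuous cdf $F_\varepsilon$. Let $F=F_{|\varepsilon|}$ be the cdf of $|\varepsilon_i|$; assume $F(x)<1$ for all $x$. Estimator. Order $|Y_{(1)}|\ge\dots\ge|Y_{(n)}|$ and put $X_{(i)}=-\log(1-F(|Y_{(i)}|))$. For $m\ge1$, $1\le j\le m$, let $s\mapsto q_{m,j}(s)$, $s\ge0$, be the continuous version of $E(S_j\mid S_m=s)$, where $S_j$ is the sum of the $j$ largest of $m$ i.i.d. standard exponential variables. Given integers $\kappa_n\ge0$, for $1\le k\le n-\kappa_n$ and $1\le j\le n-k$ let $$T_{k,j}=\sum_{i=k+1}^{k+j}X_{(i)},\qquad Q_{k,j}=q_{n-k,j}(T_{k,n-k}),\qquad \eta_k=\max_{1\le j\le n-k}\frac{|T_{k,j}-Q_{k,j}|}{\sqrt{n-k}}$$ ($Q_{k,j}$ is the conditional expectation of $T_{k,j}$ given $T_{k,n-k}$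 under the hypothesis that $X_{(k+1)},\dots,X_{(n)}$ are the order statistics of $n-k$ i.i.d. standard exponentials), and let $\hat k_n\in\operatorname{argmin}_{1\le k\le n-\kappa_n}\eta_k$ (any minimizer). Assumptions. * (AF1) There are $t^\star\in(0,1)$ and $I_n\subset\{1,\dots,n\}$ with $|I_n|=\lfloor t^\star n\rfloor$, such that $\mu_i\ne0$ for $i\in I_n$ and $\mu_i=0$ for $i\notin I_n$. * (Von Mises) Either $F$ is twice differentiable with $F'>0$ near $+\infty$ and $\frac{(1-F(x))F''(x)}{F'(x)^2}\to-1$ as $x\to\infty$ (Gumbel type), or $F$ is differentiable near $+\infty$ and $\frac{xF'(x)}{1-F(x)}\to a$ for some $a>0$ (Fréchet type). * (AF2) $|\mu_i|\ge\alpha_n$ for all $i\in I_n$, where $\alpha_n\to\infty$ fast enough to separate the nonzero means from the largest errors: $\frac{\alpha_n/2-b_n}{a_n}\to\infty$, where $b_n=\inf\{x:F(x)\ge1-1/n\}$ and $a_n=1/(nF'(b_n))$ are the extreme-value normalizing constants of $F$. * (AF3) $\kappa_n/n\to c$ with $0<c<1-t^\star$. Conclusion. For every positive decreasing sequence $(u_n)$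 with $\sqrt n\,u_n\to\infty$, $$P\Big(\Big|\frac{\hat k_n}{n}-t^\star\Big|>u_n\Big)\longrightarrow0 .$$ -/

import Mathlib

open MeasureTheory ProbabilityTheory Filter Topology

noncomputable section

/-- The values of a finite sequence rearranged in decreasing order: `decr x i` is the
`(i + 1)`-st largest value `x_{(i+1)}` (indices of `Fin n` start at `0`). -/
def decr {n : ℕ} (x : Fin n → ℝ) : Fin n → ℝ :=
  fun i => x (Tuple.sort (fun l => -x l) i)

/-- Partial sum `x_{k+1} + ⋯ + x_{k+j}` (in 1-based indexing) of a finite sequence. -/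
def windowSum {n : ℕ} (x : Fin n → ℝ) (k j : ℕ) : ℝ :=
  ∑ i : Fin n with k ≤ i.val ∧ i.val < k + j, x i

/-- The cdf `F_{|ε|}` of `|ε|`, where `ε` has law `ν`. -/
def absCdf (ν : Measure ℝ) : ℝ → ℝ :=
  fun x => cdf (ν.map (fun e => |e|)) x

/-- The transformed ordered observations `X_{(i)} = -log (1 - F(|y_{(i)}|))`, where
`|y_{(1)}| ≥ ⋯ ≥ |y_{(n)}|`. -/
def ordX (F : ℝ → ℝ) {n : ℕ} (y : Fin n → ℝ) : Fin n → ℝ :=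
  fun i => -Real.log (1 - F (decr (fun l => |y l|) i))

/-- The law of `m` independent standard exponential variables. -/
def expSample (m : ℕ) : Measure (Fin m → ℝ) :=
  Measure.pi (fun _ => expMeasure 1)

/-- `g` is the continuous version of the conditional expectation `s ↦ E(T_j | T_m = s)`, `s ≥ 0`,
where `T_j` is the sum of the `j` largest among `m` independent standard exponential variables. -/
def IsNullCondMean (m j : ℕ) (g : ℝ → ℝ) : Prop :=
  ContinuousOn g (Set.Ici 0) ∧
    (fun z : Fin m → ℝ => g (windowSum (decr z) 0 m)) =ᵐ[expSample m]
      (expSample m)[fun z : Fin m → ℝ => windowSum (decr z) 0 j |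
        MeasurableSpace.comap (fun z : Fin m → ℝ => windowSum (decr z) 0 m) inferInstance]

/-- The function `s ↦ E(T_j | T_m = s)` for `m` independent standard exponential variables
(continuous version; its values at `s ≥ 0` are determined by `IsNullCondMean` if `0 < m`). -/
def nullCondMean (m j : ℕ) : ℝ → ℝ :=
  Classical.epsilon (IsNullCondMean m j)

/-- `T_{k,j} = X_{(k+1)} + ⋯ + X_{(k+j)}`. -/
def rtT (F : ℝ → ℝ) {n : ℕ} (y : Fin n → ℝ) (k j : ℕ) : ℝ :=
  windowSum (ordX F y) k j

/-- `Q_{k,j} = E_k(T_{k,j} | T_{k,n-k})`: under the hypothesis indexed by `k`, the variables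
`X_{(k+1)}, …, X_{(n)}` are the order statistics of `n - k` independent standard exponentials. -/
def rtQ (F : ℝ → ℝ) {n : ℕ} (y : Fin n → ℝ) (k j : ℕ) : ℝ :=
  nullCondMean (n - k) j (rtT F y k (n - k))

/-- `η_k = max_{1 ≤ j ≤ n-k} |T_{k,j} - Q_{k,j}| / √(n-k)` (used for `k < n`). -/
def rtEta (F : ℝ → ℝ) {n : ℕ} (y : Fin n → ℝ) (k : ℕ) : ℝ :=
  ⨆ j : Fin (n - k), |rtT F y k (j.val + 1) - rtQ F y k (j.val + 1)| / √((n - k : ℕ) : ℝ)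

/-- `k` minimizes `η` over `1 ≤ k ≤ n - κ`. -/
def IsRTEstimate (F : ℝ → ℝ) (κ : ℕ) {n : ℕ} (y : Fin n → ℝ) (k : ℕ) : Prop :=
  (1 ≤ k ∧ k + κ ≤ n) ∧ ∀ l : ℕ, 1 ≤ l → l + κ ≤ n → rtEta F y k ≤ rtEta F y l

/-- Von Mises condition of Gumbel type at `+∞`. -/
def VonMisesGumbel (F : ℝ → ℝ) : Prop :=
  (∀ᶠ x in atTop, DifferentiableAt ℝ F x ∧ DifferentiableAt ℝ (deriv F) x ∧ 0 < deriv F x) ∧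
    Tendsto (fun x => (1 - F x) * deriv (deriv F) x / (deriv F x) ^ 2) atTop (𝓝 (-1))

/-- Von Mises condition of Fréchet type at `+∞`. -/
def VonMisesFrechet (F : ℝ → ℝ) : Prop :=
  (∀ᶠ x in atTop, DifferentiableAt ℝ F x) ∧
    ∃ a : ℝ, 0 < a ∧ Tendsto (fun x => x * deriv F x / (1 - F x)) atTop (𝓝 a)

/-- The centering constant of the maximum of `n` variables with cdf `F`: the quantile of order
`1 - 1/n`. -/
def maxCenter (F : ℝ → ℝ) (n : ℕ) : ℝ :=
  sInf {x : ℝ | 1 - 1 / (n : ℝ) ≤ F x}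

/-- The scaling constant of the maximum of `n` variables with cdf `F`: `1 / (n F'(b_n))`, with `b_n`
the quantile of order `1 - 1/n`. -/
def maxScale (F : ℝ → ℝ) (n : ℕ) : ℝ :=
  1 / ((n : ℝ) * deriv F (maxCenter F n))

end

/-! Let `K` be the number of signals and `N = n - K` the number of null observations.

Under the null hypothesis the joint density of the exponentials depends on their sum only, while the
sum of the `j` largest is homogeneous of degree one. Hence the conditional mean is exactly linear,
`s ↦ s * nullSlope m j` (`setIntegral_expSample_of_homogeneous`, `nullCondMean_eq`).

All partial sums of an ordered sample are controlled by one number. The sum of the `j` largest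
values is the minimum over `t` of `j * t` plus the total excess over `t`, and `topMean` is the same
Legendre transform of the expected excess `exp (-t)`. So the `L¹` distance `tailDev` between the
tail counts bounds the error for every `j` at once (`abs_windowSum_sub_topMean_le`), and its mean is
at most `2 * √N` (`lintegral_tailDev_le`). In particular `nullSlope m j` is within `2 / √m` of
`topMean (j / m)`.

The von Mises condition and the separation of the means give `n * (1 - F (α n / 2)) → 0`
(`tendsto_mul_survival`). So, with probability tending to one, the signals occupy the first `K`
places with transformed values at least `log n`, the remaining values are an ordered exponential
sample, and its `tailDev` is below `ρ * √N`.

On this event `η_K ≤ 2 * ρ + 2` (`windowEta_le`), and every `k` too far from `K` has a larger `η_k`.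
If `k < K`, the leading `K - k` values are signals and their sum far exceeds its null share
(`lt_windowEta_of_lt`). If `k > K`, an exponential sample has lost its largest values, and the upper
half of what is left carries too small a share of the total (`lt_windowEta_of_gt`). The deficit is
linear in `k - K`, by a strict supermultiplicativity of the exponential Lorenz curve: that curve is
a probability generating function, so the inequality is a positive covariance (`expLorenz_mul_sub`).
Letting `ρ → ∞` slowly compared with `√n * u n` and `√n` concludes. -/

/-! ### The exponential quantile integral and the Lorenz curve. -/

/-- The integral over `[0, x]` of the exponential quantile function `r ↦ -log r`. -/
noncomputable def topMean (x : ℝ) : ℝ := x - x * Real.log x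

/-- The Lorenz curve of the standard exponential distribution. -/
noncomputable def expLorenz (a : ℝ) : ℝ := 1 - topMean (1 - a)

lemma topMean_zero : topMean 0 = 0 := by simp [topMean]

lemma topMean_one : topMean 1 = 1 := by simp [topMean]

/-- The Fenchel–Young inequality behind all comparisons below; equality holds at `t = -log x`, which
is `topMean_eq`. -/
lemma topMean_le {x : ℝ} (hx : 0 ≤ x) (t : ℝ) : topMean x ≤ x * t + Real.exp (-t) := by
  rcases hx.eq_or_lt with rfl | hx
  · simpa [topMean_zero] using (Real.exp_pos _).le
  · have h := Real.log_le_sub_one_of_pos (div_pos (Real.exp_pos (-t)) hx)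
    rw [Real.log_div (Real.exp_pos _).ne' hx.ne', Real.log_exp] at h
    have h2 := mul_le_mul_of_nonneg_left h hx.le
    have h3 : x * (Real.exp (-t) / x - 1) = Real.exp (-t) - x := by field_simp
    rw [h3] at h2
    unfold topMean
    linarith

lemma topMean_eq {x : ℝ} (hx : 0 < x) :
    topMean x = x * (-Real.log x) + Real.exp (-(-Real.log x)) := by
  rw [neg_neg, Real.exp_log hx, topMean]
  ring

lemma topMean_nonneg {x : ℝ} (hx : 0 ≤ x) (hx1 : x ≤ 1) : 0 ≤ topMean x := by
  have := mul_nonneg hx (neg_nonneg.2 (Real.log_nonpos hx hx1))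
  unfold topMean
  linarith

lemma topMean_le_one {x : ℝ} (hx : 0 ≤ x) : topMean x ≤ 1 := by
  simpa using topMean_le hx 0

lemma topMean_lt_one {x : ℝ} (hx : 0 ≤ x) (hx1 : x < 1) : topMean x < 1 := by
  rcases hx.eq_or_lt with rfl | hx
  · simp [topMean_zero]
  · have h := Real.log_lt_sub_one_of_pos (inv_pos.2 hx) (by
      intro h
      rw [inv_eq_one] at h
      exact hx1.ne h)
    rw [Real.log_inv] at h
    have h2 := mul_lt_mul_of_pos_left h hx
    have h3 : x * (x⁻¹ - 1) = 1 - x := by field_simp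
    rw [h3] at h2
    unfold topMean
    linarith

lemma topMean_mono {x y : ℝ} (hx : 0 ≤ x) (hxy : x ≤ y) (hy : y ≤ 1) :
    topMean x ≤ topMean y := by
  rcases hx.eq_or_lt with rfl | hx
  · rw [topMean_zero]
    exact topMean_nonneg hxy hy
  · rw [topMean_eq (hx.trans_le hxy)]
    refine (topMean_le hx.le (-Real.log y)).trans ?_
    have : 0 ≤ -Real.log y := neg_nonneg.2 (Real.log_nonpos (hx.le.trans hxy) hy)
    gcongr

lemma hasSum_inv_mul_succ :
    HasSum (fun k : ℕ => 1 / (((k : ℝ) + 1) * ((k : ℝ) + 2))) 1 := by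
  rw [hasSum_iff_tendsto_nat_of_nonneg (fun k => by positivity)]
  have h : ∀ n : ℕ, ∑ k ∈ Finset.range n, 1 / (((k : ℝ) + 1) * ((k : ℝ) + 2))
      = 1 - 1 / ((n : ℝ) + 1) := by
    intro n
    induction n with
    | zero => simp
    | succ n ih =>
      rw [Finset.sum_range_succ, ih]
      push_cast
      field_simp
      ring
  simp_rw [h]
  simpa using tendsto_one_div_add_atTop_nhds_zero_nat.const_sub (1 : ℝ)

/-- The coefficients are nonnegative with sum one by `hasSum_inv_mul_succ`, so the Lorenz curve is
the generating function of a probability law on the exponents `2, 3, …`. -/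
lemma hasSum_expLorenz {a : ℝ} (ha : 0 ≤ a) (ha1 : a < 1) :
    HasSum (fun k : ℕ => 1 / (((k : ℝ) + 1) * ((k : ℝ) + 2)) * a ^ (k + 2)) (expLorenz a) := by
  have h := Real.hasSum_pow_div_log_of_abs_lt_one (x := a) (by rwa [abs_of_nonneg ha])
  have h1 := (hasSum_nat_add_iff' 1).2 h
  have h2 := (h.mul_left a).sub h1
  simp only [Finset.range_one, Finset.sum_singleton] at h2
  convert! h2 using 1
  · funext k
    push_cast
    field_simp
    ring
  · unfold expLorenz topMean
    norm_num
    ring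

lemma sq_div_two_le_expLorenz {b : ℝ} (hb : 0 ≤ b) (hb1 : b < 1) : b ^ 2 / 2 ≤ expLorenz b := by
  have h := le_hasSum (hasSum_expLorenz hb hb1) 0 (fun k _ => by positivity)
  norm_num at h
  linarith

/-- Half of the probability sits at exponent `2`; on the other half every power is at most `b ^ 3`.
-/
lemma expLorenz_le {b : ℝ} (hb : 0 ≤ b) (hb1 : b < 1) :
    expLorenz b ≤ (b ^ 2 + b ^ 3) / 2 := by
  have h := hasSum_expLorenz hb hb1
  have h2 := (hasSum_inv_mul_succ.mul_right (b ^ 3)).add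
    (hasSum_ite_eq (0 : ℕ) ((b ^ 2 - b ^ 3) / 2))
  have := hasSum_le (fun k => ?_) h h2
  · linarith
  · rcases k with _ | k
    · norm_num
      linarith
    · simp only [Nat.add_eq_zero_iff, one_ne_zero, and_false, if_false, add_zero]
      have : b ^ (k + 1 + 2) ≤ b ^ 3 := pow_le_pow_of_le_one hb hb1.le (by omega)
      gcongr

/-- Quantitative supermultiplicativity of the Lorenz curve of the exponential distribution. -/
lemma expLorenz_mul_sub {a b : ℝ} (ha : 0 ≤ a) (ha1 : a < 1) (hb : 1 / 4 ≤ b) (hb1 : b ≤ 1 / 2) :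
    a ^ 2 * (1 - a) / 128 ≤ expLorenz (a * b) - expLorenz a * expLorenz b := by
  have hb0 : 0 ≤ b := by linarith
  have hb2 : b < 1 := by linarith
  set v := expLorenz b with hv
  have hv1 : b ^ 2 / 2 ≤ v := sq_div_two_le_expLorenz hb0 hb2
  have hv2 : v ≤ (b ^ 2 + b ^ 3) / 2 := expLorenz_le hb0 hb2
  have hab : HasSum _ (expLorenz (a * b)) :=
    hasSum_expLorenz (mul_nonneg ha hb0) (by nlinarith)
  -- The sum of `h` is the covariance of `a ^ X` and `b ^ X`. Its terms are compared with those of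
  -- `h2`, in which `a ^ X` is replaced by `a ^ 3` and a correction is made at exponent `2`; since
  -- `b ^ X - v` has mean zero, only the correction survives.
  have h := hab.sub ((hasSum_expLorenz ha ha1).mul_right v)
  have h2 := (((hasSum_expLorenz hb0 hb2).sub (hasSum_inv_mul_succ.mul_right v)).mul_left
    (a ^ 3)).add (hasSum_ite_eq (0 : ℕ) ((b ^ 2 - v) / 2 * (a ^ 2 - a ^ 3)))
  rw [← hv, one_mul, sub_self, mul_zero, zero_add] at h2
  have key := hasSum_le (fun k => ?_) h2 h
  · refine le_trans ?_ key
    have h3 : 1 / 64 ≤ (b ^ 2 - v) / 2 * 2 := by nlinarith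
    have h4 : 0 ≤ a ^ 2 - a ^ 3 := by nlinarith [sq_nonneg a]
    nlinarith
  · rcases k with _ | k
    · norm_num
      apply le_of_eq
      ring
    · simp only [Nat.add_eq_zero_iff, one_ne_zero, and_false, if_false, add_zero]
      have e1 : a ^ (k + 1 + 2) ≤ a ^ 3 := pow_le_pow_of_le_one ha ha1.le (by omega)
      have e2 : b ^ (k + 1 + 2) ≤ b ^ 3 := pow_le_pow_of_le_one hb0 hb2.le (by omega)
      -- Here `b ≤ 1 / 2` matters: `b ^ 3 ≤ b ^ 2 / 2 ≤ v`. Beyond exponent `2` both factors then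
      -- have the same sign.
      have e3 : b ^ (k + 1 + 2) ≤ v := by nlinarith [sq_nonneg b]
      have e4 : 0 ≤ 1 / ((((k + 1 : ℕ) : ℝ) + 1) * (((k + 1 : ℕ) : ℝ) + 2)) := by positivity
      have := mul_nonneg e4 (mul_nonneg (sub_nonneg.2 e1) (sub_nonneg.2 e3))
      rw [mul_pow]
      linarith

/-- The same inequality in terms of the top means. -/
lemma topMean_gap {a r : ℝ} (ha : 0 ≤ a) (ha1 : a < 1) (hr : 1 / 2 ≤ r) (hr1 : r ≤ 3 / 4) :
    a ^ 2 * (1 - a) / 128 ≤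
      topMean r * (1 - topMean (1 - a)) - (topMean (1 - a * (1 - r)) - topMean (1 - a)) := by
  have h := expLorenz_mul_sub ha ha1 (b := 1 - r) (by linarith) (by linarith)
  unfold expLorenz at h
  rw [sub_sub_cancel] at h
  linarith

/-! ### Deviation of the tail counts from the exponential tail. -/

/-- The `L¹` distance on `(0, ∞)` between the tail count of the values `x i`, `i ∈ T`, and the
expected tail count of `#T` standard exponential variables. -/
noncomputable def tailDev {ι : Type*} (T : Finset ι) (x : ι → ℝ) : ℝ :=
  ∫ t in Set.Ioi (0 : ℝ), |(((T.filter (fun i => t < x i)).card : ℕ) : ℝ) - T.card * Real.exp (-t)|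

section tailDev

variable {ι : Type*} (T : Finset ι) (x : ι → ℝ)

lemma card_filter_lt_eq_sum_indicator (t : ℝ) :
    (((T.filter (fun i => t < x i)).card : ℕ) : ℝ)
      = ∑ i ∈ T, (Set.Iio (x i)).indicator (fun _ => (1 : ℝ)) t := by
  rw [Finset.card_filter]
  push_cast
  refine Finset.sum_congr rfl fun i _ => ?_
  simp [Set.indicator_apply]

lemma tailDev_nonneg : 0 ≤ tailDev T x := integral_nonneg fun _ => abs_nonneg _

lemma integrableOn_indicator_Iio (a t : ℝ) :
    IntegrableOn ((Set.Iio a).indicator (fun _ => (1 : ℝ))) (Set.Ioi t) := by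
  rw [IntegrableOn, integrable_indicator_iff measurableSet_Iio, IntegrableOn,
    Measure.restrict_restrict measurableSet_Iio]
  refine integrableOn_const (by
    rw [Set.inter_comm, Set.Ioi_inter_Iio]
    simp)

lemma setIntegral_indicator_Iio (a t : ℝ) :
    ∫ s in Set.Ioi t, (Set.Iio a).indicator (fun _ => (1 : ℝ)) s = max (a - t) 0 := by
  rw [setIntegral_indicator measurableSet_Iio, Set.Ioi_inter_Iio, setIntegral_const]
  simp [Measure.real, Real.volume_Ioo, ENNReal.toReal_ofReal']

lemma integrableOn_card_sub_exp (t : ℝ) :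
    IntegrableOn (fun t => (((T.filter (fun i => t < x i)).card : ℕ) : ℝ)
      - T.card * Real.exp (-t)) (Set.Ioi t) := by
  simp_rw [card_filter_lt_eq_sum_indicator]
  refine Integrable.sub (integrable_finsetSum _ fun i _ => integrableOn_indicator_Iio _ _) ?_
  refine Integrable.const_mul ?_ _
  simpa [IntegrableOn] using exp_neg_integrableOn_Ioi t one_pos

/-- The total excess over any level `t ≥ 0` deviates from its expected value by at most
`tailDev`. -/
lemma abs_sum_excess_sub_le_tailDev {t : ℝ} (ht : 0 ≤ t) :
    |∑ i ∈ T, max (x i - t) 0 - T.card * Real.exp (-t)| ≤ tailDev T x := by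
  have h : ∫ s in Set.Ioi t, ((((T.filter (fun i => s < x i)).card : ℕ) : ℝ)
      - T.card * Real.exp (-s)) = ∑ i ∈ T, max (x i - t) 0 - T.card * Real.exp (-t) := by
    simp_rw [card_filter_lt_eq_sum_indicator]
    rw [integral_sub, integral_finsetSum, integral_const_mul, integral_exp_neg_Ioi]
    · simp_rw [setIntegral_indicator_Iio]
    · exact fun i _ => integrableOn_indicator_Iio _ _
    · exact integrable_finsetSum _ fun i _ => integrableOn_indicator_Iio _ _
    · refine Integrable.const_mul ?_ _
      simpa [IntegrableOn] using exp_neg_integrableOn_Ioi t one_pos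
  rw [← h]
  refine (abs_integral_le_integral_abs).trans ?_
  refine setIntegral_mono_set (integrableOn_card_sub_exp T x 0).abs ?_ ?_
  · exact Eventually.of_forall fun _ => abs_nonneg _
  · exact (Set.Ioi_subset_Ioi ht).eventuallyLE

lemma tailDev_comp_equiv {ι' : Type*} (e : ι ≃ ι') (x : ι' → ℝ) :
    tailDev T (fun i => x (e i)) = tailDev (T.map e.toEmbedding) x := by
  unfold tailDev
  simp only [Finset.filter_map, Finset.card_map, Function.comp_def, Equiv.coe_toEmbedding]

lemma tailDev_congr {x x' : ι → ℝ} (h : ∀ i ∈ T, x i = x' i) : tailDev T x = tailDev T x' := by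
  unfold tailDev
  congr 1
  ext t
  rw [Finset.filter_congr (fun i hi => by rw [h i hi])]

end tailDev

/-! ### Partial sums of decreasing sequences. -/

section windowSum

variable {n : ℕ}

lemma map_val_filter_window {k j : ℕ} (h : k + j ≤ n) :
    ((Finset.univ : Finset (Fin n)).filter (fun i => k ≤ i.val ∧ i.val < k + j)).map
      Fin.valEmbedding = Finset.Ico k (k + j) := by
  ext l
  simp only [Finset.mem_map, Finset.mem_filter, Finset.mem_univ, true_and, Finset.mem_Ico,
    Fin.valEmbedding_apply]
  exact ⟨fun ⟨i, hi, hl⟩ => hl ▸ hi, fun hl => ⟨⟨l, by omega⟩, hl, rfl⟩⟩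

lemma card_filter_window (k j : ℕ) (h : k + j ≤ n) :
    ((Finset.univ : Finset (Fin n)).filter (fun i => k ≤ i.val ∧ i.val < k + j)).card = j := by
  rw [← Finset.card_map Fin.valEmbedding, map_val_filter_window h, Nat.card_Ico,
    Nat.add_sub_cancel_left]

lemma card_filter_le_val (k : ℕ) :
    ((Finset.univ : Finset (Fin n)).filter (fun i => k ≤ i.val)).card = n - k := by
  rcases le_total k n with h | h
  · have := card_filter_window (n := n) k (n - k) (by omega)
    rwa [Finset.filter_congr (q := fun i : Fin n => k ≤ i.val) (fun i _ => by omega)] at this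
  · rw [Finset.filter_false_of_mem (fun i _ => by omega), Finset.card_empty]
    omega

lemma windowSum_zero (s : Fin n → ℝ) (k : ℕ) : windowSum s k 0 = 0 := by
  unfold windowSum
  rw [Finset.filter_false_of_mem, Finset.sum_empty]
  intro i _
  omega

lemma windowSum_add (s : Fin n → ℝ) (k i j : ℕ) :
    windowSum s k (i + j) = windowSum s k i + windowSum s (k + i) j := by
  unfold windowSum
  rw [← Finset.sum_union]
  · refine Finset.sum_congr ?_ fun _ _ => rfl
    ext l
    simp only [Finset.mem_filter, Finset.mem_univ, true_and, Finset.mem_union]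
    omega
  · rw [Finset.disjoint_left]
    intro l
    simp only [Finset.mem_filter, Finset.mem_univ, true_and]
    omega

lemma windowSum_nonneg {s : Fin n → ℝ} (hs : ∀ i, 0 ≤ s i) (k j : ℕ) : 0 ≤ windowSum s k j :=
  Finset.sum_nonneg fun i _ => hs i

lemma windowSum_mono_length {s : Fin n → ℝ} (hs : ∀ i, 0 ≤ s i) (k : ℕ) {j l : ℕ} (h : j ≤ l) :
    windowSum s k j ≤ windowSum s k l := by
  obtain ⟨d, rfl⟩ := Nat.exists_eq_add_of_le h
  rw [windowSum_add]
  linarith [windowSum_nonneg hs (k + j) d]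

lemma windowSum_full (s : Fin n → ℝ) : windowSum s 0 n = ∑ i, s i := by
  unfold windowSum
  rw [Finset.filter_true_of_mem]
  intro i _
  omega

lemma mul_le_windowSum {s : Fin n → ℝ} {k j : ℕ} {L : ℝ} (h : k + j ≤ n)
    (hs : ∀ i : Fin n, i.val < k + j → L ≤ s i) : j * L ≤ windowSum s k j := by
  have := Finset.card_nsmul_le_sum
    (Finset.univ.filter (fun i : Fin n => k ≤ i.val ∧ i.val < k + j)) s L (by
      intro i hi
      exact hs i (Finset.mem_filter.1 hi).2.2)
  rwa [card_filter_window k j h, nsmul_eq_mul] at this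

/-- The easy half of the variational formula for sums of largest values, valid at every level `t`;
`windowSum_eq_excess` is the equality case, with `t` the last value in the window. -/
lemma windowSum_le_excess (s : Fin n → ℝ) {k j : ℕ} (h : k + j ≤ n) (t : ℝ) :
    windowSum s k j ≤ j * t
      + ∑ i ∈ Finset.univ.filter (fun i : Fin n => k ≤ i.val), max (s i - t) 0 := by
  have h1 : windowSum s k j = j * t
      + ∑ i : Fin n with k ≤ i.val ∧ i.val < k + j, (s i - t) := by
    rw [Finset.sum_sub_distrib, Finset.sum_const, card_filter_window k j h, nsmul_eq_mul]
    unfold windowSum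
    ring
  rw [h1]
  gcongr
  refine (Finset.sum_le_sum fun i _ => le_max_left (s i - t) 0).trans ?_
  refine Finset.sum_le_sum_of_subset_of_nonneg ?_ fun i _ _ => le_max_right _ _
  exact Finset.monotone_filter_right _ fun i _ hi => hi.1

lemma windowSum_eq_excess {s : Fin n → ℝ} (hs : Antitone s) {k j : ℕ} (h : k + j < n) :
    windowSum s k (j + 1) = (j + 1 : ℕ) * s ⟨k + j, h⟩
      + ∑ i ∈ Finset.univ.filter (fun i : Fin n => k ≤ i.val), max (s i - s ⟨k + j, h⟩) 0 := by
  set t := s ⟨k + j, h⟩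
  have h1 : windowSum s k (j + 1) = (j + 1 : ℕ) * t
      + ∑ i : Fin n with k ≤ i.val ∧ i.val < k + (j + 1), (s i - t) := by
    rw [Finset.sum_sub_distrib, Finset.sum_const, card_filter_window k _ (by omega), nsmul_eq_mul]
    unfold windowSum
    ring
  rw [h1]
  congr 1
  have h2 : ∑ i : Fin n with k ≤ i.val ∧ i.val < k + (j + 1), (s i - t)
      = ∑ i : Fin n with k ≤ i.val ∧ i.val < k + (j + 1), max (s i - t) 0 := by
    refine Finset.sum_congr rfl fun i hi => ?_
    have : t ≤ s i := hs (by
      rw [Fin.le_def]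
      have := (Finset.mem_filter.1 hi).2
      simp only
      omega)
    rw [max_eq_left (by linarith)]
  rw [h2]
  refine Finset.sum_subset (Finset.monotone_filter_right _ fun i _ hi => hi.1) fun i hi hi' => ?_
  have : s i ≤ t := hs (by
    rw [Fin.le_def]
    simp only [Finset.mem_filter, Finset.mem_univ, true_and] at hi hi'
    simp only
    omega)
  rw [max_eq_right (by linarith)]

/-- The sums of the largest values of a decreasing sequence differ from the corresponding
exponential means by at most `tailDev`. -/
lemma abs_windowSum_sub_topMean_le {s : Fin n → ℝ} (hs : Antitone s) (hs0 : ∀ i, 0 ≤ s i)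
    {k j : ℕ} (h : k + j ≤ n) :
    |windowSum s k j - ((n - k : ℕ) : ℝ) * topMean (j / ((n - k : ℕ) : ℝ))|
      ≤ tailDev (Finset.univ.filter (fun i : Fin n => k ≤ i.val)) s := by
  set R := tailDev (Finset.univ.filter (fun i : Fin n => k ≤ i.val)) s with hR
  have hcard := card_filter_le_val (n := n) k
  have hdev : ∀ t : ℝ, 0 ≤ t → |∑ i ∈ Finset.univ.filter (fun i : Fin n => k ≤ i.val),
      max (s i - t) 0 - ((n - k : ℕ) : ℝ) * Real.exp (-t)| ≤ R := by
    intro t ht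
    have := abs_sum_excess_sub_le_tailDev (Finset.univ.filter (fun i : Fin n => k ≤ i.val)) s ht
    rwa [hcard] at this
  rcases j with _ | j
  · simpa [windowSum_zero, topMean_zero] using tailDev_nonneg _ _
  set N : ℝ := ((n - k : ℕ) : ℝ) with hN
  have hNpos : 0 < N := by
    rw [hN]
    exact_mod_cast (by omega : 0 < n - k)
  have hjN : ((j + 1 : ℕ) : ℝ) ≤ N := by
    rw [hN]
    exact_mod_cast (by omega : j + 1 ≤ n - k)
  set J : ℝ := ((j + 1 : ℕ) : ℝ) with hJ
  have hJpos : 0 < J := by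
    rw [hJ]
    positivity
  have hr : 0 < J / N := div_pos hJpos hNpos
  have hr1 : J / N ≤ 1 := (div_le_one hNpos).2 hjN
  have hNJ : N * (J / N) = J := by field_simp
  rw [abs_le]
  constructor
  -- Lower bound: the level is the last value in the window, exact for the sum and suboptimal for
  -- `topMean`.
  · have h1 := windowSum_eq_excess hs (k := k) (j := j) (by omega)
    have h2 := abs_le.1 (hdev _ (hs0 ⟨k + j, by omega⟩))
    have h3 := mul_le_mul_of_nonneg_left (topMean_le hr.le (s ⟨k + j, by omega⟩)) hNpos.le
    rw [mul_add, ← mul_assoc, hNJ] at h3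
    linarith [h2.1]
  -- Upper bound: the level is the exponential quantile, exact for `topMean` and suboptimal for the
  -- sum.
  · have ht : 0 ≤ -Real.log (J / N) := neg_nonneg.2 (Real.log_nonpos hr.le hr1)
    have h1 := windowSum_le_excess s h (-Real.log (J / N))
    have h2 := abs_le.1 (hdev _ ht)
    have h3 := congrArg (N * ·) (topMean_eq hr)
    simp only [mul_add, ← mul_assoc, hNJ] at h3
    linarith [h2.2]

end windowSum

/-! ### Decreasing rearrangements. -/

section decr

variable {n : ℕ}

lemma antitone_decr (x : Fin n → ℝ) : Antitone (decr x) := by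
  have h := Tuple.monotone_sort (fun l => -x l)
  intro i j hij
  have := h hij
  simpa [decr] using this

lemma decr_eq_comp_of_antitone {x : Fin n → ℝ} {σ : Equiv.Perm (Fin n)}
    (h : Antitone (x ∘ σ)) : decr x = x ∘ σ :=
  Tuple.unique_antitone (antitone_decr x) h

lemma decr_comp_monotone {φ : ℝ → ℝ} (hφ : Monotone φ) (x : Fin n → ℝ) :
    decr (φ ∘ x) = φ ∘ decr x :=
  decr_eq_comp_of_antitone (σ := Tuple.sort (fun l => -x l)) (hφ.comp_antitone (antitone_decr x))

lemma sum_comp_decr (f : ℝ → ℝ) (x : Fin n → ℝ) : ∑ i, f (decr x i) = ∑ i, f (x i) :=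
  Equiv.sum_comp (Tuple.sort (fun l => -x l)) (fun i => f (x i))

lemma tailDev_decr (x : Fin n → ℝ) : tailDev Finset.univ (decr x) = tailDev Finset.univ x := by
  have := tailDev_comp_equiv Finset.univ (Tuple.sort (fun l => -x l)) x
  rw [Finset.map_univ_equiv] at this
  exact this

lemma card_filter_lt_decr (x : Fin n → ℝ) (a : ℝ) :
    (Finset.univ.filter (fun i => a < decr x i)).card
      = (Finset.univ.filter (fun i => a < x i)).card := by
  have h := Finset.filter_map (f := (Tuple.sort (fun l => -x l)).toEmbedding)
    (s := Finset.univ) (p := fun i => a < x i)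
  rw [Finset.map_univ_equiv] at h
  rw [h, Finset.card_map]
  rfl

/-- An order statistic exceeds `a` exactly when enough coordinates do, and the number of such
coordinates is measurable. -/
lemma measurable_decr (i : Fin n) : Measurable (fun x : Fin n → ℝ => decr x i) := by
  refine measurable_of_Ioi fun a => ?_
  have h : (fun x : Fin n → ℝ => decr x i) ⁻¹' Set.Ioi a
      = {x | (i : ℝ) < ∑ l, (Set.Ioi a).indicator (fun _ => (1 : ℝ)) (x l)} := by
    ext x
    have h1 := Tuple.lt_card_gt_iff_apply_gt_of_antitone (j := i) (a := a) (antitone_decr x)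
    rw [card_filter_lt_decr] at h1
    rw [Set.mem_preimage, Set.mem_Ioi, ← h1, Set.mem_ofPred_eq]
    have h2 : ∑ l, (Set.Ioi a).indicator (fun _ => (1 : ℝ)) (x l)
        = (((Finset.univ.filter (fun i => a < x i)).card : ℕ) : ℝ) := by
      rw [Finset.card_filter]
      push_cast
      refine Finset.sum_congr rfl fun i _ => ?_
      simp [Set.indicator_apply]
    rw [h2]
    exact_mod_cast Iff.rfl
  rw [h]
  refine measurableSet_lt measurable_const (Finset.measurable_sum _ fun l _ => ?_)
  exact (measurable_const.indicator measurableSet_Ioi).comp (measurable_pi_apply l)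

lemma measurable_windowSum_decr (k j : ℕ) :
    Measurable (fun x : Fin n → ℝ => windowSum (decr x) k j) :=
  Finset.measurable_sum _ fun i _ => measurable_decr i

lemma windowSum_decr_full (x : Fin n → ℝ) : windowSum (decr x) 0 n = ∑ i, x i := by
  rw [windowSum_full]
  exact sum_comp_decr id x

lemma windowSum_decr_smul {a : ℝ} (ha : 0 ≤ a) (x : Fin n → ℝ) (k j : ℕ) :
    windowSum (decr (a • x)) k j = a * windowSum (decr x) k j := by
  have : decr (a • x) = (fun t => a * t) ∘ decr x :=
    decr_comp_monotone (fun s t hst => mul_le_mul_of_nonneg_left hst ha) x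
  rw [this]
  unfold windowSum
  rw [Finset.mul_sum]
  rfl

/-- If the values indexed by `I` exceed all others, sorting moves them to the first positions. -/
lemma map_sort_filter_eq_compl {y : Fin n → ℝ} {I : Finset (Fin n)} {β : ℝ}
    (h1 : ∀ i ∈ I, β < y i) (h2 : ∀ i ∉ I, y i < β) :
    (Finset.univ.filter (fun i : Fin n => I.card ≤ i.val)).map
      (Tuple.sort (fun l => -y l)).toEmbedding = Iᶜ := by
  set σ := Tuple.sort (fun l => -y l) with hσ
  have hmem : ∀ i : Fin n, σ i ∈ I ↔ β < decr y i := fun i =>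
    ⟨fun h => h1 _ h, fun h => by
      by_contra hi
      exact absurd (h2 _ hi) (not_lt.2 (le_of_lt h))⟩
  have hcard : (Finset.univ.filter (fun i => β < decr y i)).card = I.card := by
    rw [card_filter_lt_decr]
    congr 1
    ext i
    simp only [Finset.mem_filter, Finset.mem_univ, true_and]
    exact ⟨fun h => by
      by_contra hi
      exact absurd (h2 _ hi) (not_lt.2 (le_of_lt h)), h1 i⟩
  have hlt : ∀ i : Fin n, i.val < I.card ↔ σ i ∈ I := by
    intro i
    rw [hmem, ← hcard]
    exact Tuple.lt_card_gt_iff_apply_gt_of_antitone (j := i) (a := β) (antitone_decr y)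
  ext l
  simp only [Finset.mem_map_equiv, Finset.mem_filter, Finset.mem_univ, true_and,
    Finset.mem_compl]
  have := hlt (σ.symm l)
  rw [Equiv.apply_symm_apply] at this
  rw [← this, not_lt]

end decr

/-! ### Mean tail deviation of an exponential sample. -/

section tailDevMean

variable {Ω ι : Type*} [MeasurableSpace Ω] {P : Measure Ω} [IsProbabilityMeasure P]
  {T : Finset ι} {Z : ι → Ω → ℝ}

lemma integral_abs_le_sqrt_integral_sq {f : Ω → ℝ} (hf : MemLp f 2 P) :
    ∫ ω, |f ω| ∂P ≤ √(∫ ω, f ω ^ 2 ∂P) := by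
  have h := variance_nonneg |f| P
  rw [variance_eq_sub hf.abs] at h
  refine Real.le_sqrt_of_sq_le ?_
  simpa using h

/-- The first absolute moment is at most the standard deviation; the variance of a sum of pairwise
independent indicators is at most the mean of the sum. -/
lemma integral_abs_card_sub_exp_le (hZ : ∀ i ∈ T, Measurable (Z i))
    (hind : (T : Set ι).Pairwise fun i j => IndepFun (Z i) (Z j) P)
    {t : ℝ} (htail : ∀ i ∈ T, P.real {ω | t < Z i ω} = Real.exp (-t)) :
    ∫ ω, |(((T.filter (fun i => t < Z i ω)).card : ℕ) : ℝ) - T.card * Real.exp (-t)| ∂P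
      ≤ √T.card * Real.exp (-(1 / 2 * t)) := by
  set X : ι → Ω → ℝ := fun i ω => (Set.Ioi t).indicator (fun _ => (1 : ℝ)) (Z i ω) with hX
  have hg : Measurable ((Set.Ioi t).indicator (fun _ => (1 : ℝ))) :=
    measurable_const.indicator measurableSet_Ioi
  have hXL : ∀ i ∈ T, MemLp (X i) 2 P := fun i hi =>
    MemLp.of_bound (hg.comp (hZ i hi)).aestronglyMeasurable 1 (Eventually.of_forall fun ω => by
      simp only [hX, Set.indicator_apply]
      split_ifs <;> simp)
  have hXint : ∀ i ∈ T, ∫ ω, X i ω ∂P = Real.exp (-t) := by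
    intro i hi
    rw [← htail i hi, ← integral_indicator_one (measurableSet_lt measurable_const (hZ i hi))]
    rfl
  have hsum : ∀ ω, (((T.filter (fun i => t < Z i ω)).card : ℕ) : ℝ) = (∑ i ∈ T, X i) ω := by
    intro ω
    rw [Finset.card_filter, Finset.sum_apply]
    push_cast
    refine Finset.sum_congr rfl fun i _ => ?_
    simp [hX, Set.indicator_apply]
  have hSL : MemLp (∑ i ∈ T, X i) 2 P := memLp_finsetSum' _ hXL
  have hmean : ∫ ω, (∑ i ∈ T, X i) ω ∂P = T.card * Real.exp (-t) := by
    simp_rw [Finset.sum_apply]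
    rw [integral_finsetSum _ fun i hi => (hXL i hi).integrable (by norm_num),
      Finset.sum_congr rfl hXint, Finset.sum_const, nsmul_eq_mul]
  have hvar : ∫ ω, ((∑ i ∈ T, X i) ω - T.card * Real.exp (-t)) ^ 2 ∂P
      ≤ T.card * Real.exp (-t) := by
    rw [← hmean, ← variance_eq_integral hSL.aemeasurable, IndepFun.variance_sum hXL
      (fun i hi j hj hij => (hind hi hj hij).comp hg hg), hmean, ← nsmul_eq_mul,
      ← Finset.sum_const]
    refine Finset.sum_le_sum fun i hi => ?_
    refine (variance_le_expectation_sq (hXL i hi).aestronglyMeasurable).trans ?_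
    rw [← hXint i hi]
    refine le_of_eq (integral_congr_ae (Eventually.of_forall fun ω => ?_))
    simp only [hX, Pi.pow_apply, Set.indicator_apply]
    split_ifs <;> simp
  simp_rw [hsum]
  refine (integral_abs_le_sqrt_integral_sq (hSL.sub (memLp_const _))).trans ?_
  refine (Real.sqrt_le_sqrt hvar).trans ?_
  rw [Real.sqrt_mul (by positivity), Real.sqrt_eq_rpow (Real.exp _), ← Real.exp_mul]
  apply le_of_eq
  ring_nf

lemma measurable_uncurry_card (hZ : ∀ i ∈ T, Measurable (Z i)) :
    Measurable (fun p : Ω × ℝ =>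
      |(((T.filter (fun i => p.2 < Z i p.1)).card : ℕ) : ℝ) - T.card * Real.exp (-p.2)|) := by
  have : ∀ p : Ω × ℝ, (((T.filter (fun i => p.2 < Z i p.1)).card : ℕ) : ℝ)
      = ∑ i ∈ T, ({p : Ω × ℝ | p.2 < Z i p.1}).indicator (fun _ => (1 : ℝ)) p := by
    intro p
    rw [Finset.card_filter]
    push_cast
    refine Finset.sum_congr rfl fun i _ => ?_
    simp [Set.indicator_apply]
  simp_rw [this]
  refine Measurable.abs (Measurable.sub (Finset.measurable_fun_sum _ fun i hi => ?_) (by fun_prop))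
  exact measurable_const.indicator
    (measurableSet_lt measurable_snd ((hZ i hi).comp measurable_fst))

lemma measurable_tailDev (hZ : ∀ i ∈ T, Measurable (Z i)) :
    Measurable (fun ω => tailDev T (fun i => Z i ω)) := by
  have h := (measurable_uncurry_card hZ).stronglyMeasurable
  exact (StronglyMeasurable.integral_prod_right (ν := volume.restrict (Set.Ioi (0 : ℝ))) h).measurable

/-- The mean `tailDev` of pairwise independent standard exponential variables. -/
lemma lintegral_tailDev_le (hZ : ∀ i ∈ T, Measurable (Z i))
    (hind : (T : Set ι).Pairwise fun i j => IndepFun (Z i) (Z j) P)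
    (htail : ∀ i ∈ T, ∀ t : ℝ, 0 ≤ t → P.real {ω | t < Z i ω} = Real.exp (-t)) :
    ∫⁻ ω, ENNReal.ofReal (tailDev T (fun i => Z i ω)) ∂P ≤ ENNReal.ofReal (2 * √T.card) := by
  have hm := measurable_uncurry_card (T := T) hZ
  have h1 : ∀ ω, ENNReal.ofReal (tailDev T (fun i => Z i ω)) = ∫⁻ t in Set.Ioi (0 : ℝ),
      ENNReal.ofReal |(((T.filter (fun i => t < Z i ω)).card : ℕ) : ℝ)
        - T.card * Real.exp (-t)| := fun ω =>
    ofReal_integral_eq_lintegral_ofReal (integrableOn_card_sub_exp T (fun i => Z i ω) 0).abs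
      (Eventually.of_forall fun _ => abs_nonneg _)
  simp_rw [h1]
  rw [lintegral_lintegral_swap hm.ennreal_ofReal.aemeasurable]
  have hint : IntegrableOn (fun t => √T.card * Real.exp (-(1 / 2 * t))) (Set.Ioi 0) := by
    refine Integrable.const_mul ?_ _
    simpa [IntegrableOn] using exp_neg_integrableOn_Ioi 0 (one_half_pos (α := ℝ))
  -- The square root halves the exponential rate, so integrating the standard deviation over the
  -- levels costs only the factor `2`.
  have h2 : ∫ t in Set.Ioi (0 : ℝ), √T.card * Real.exp (-(1 / 2 * t)) = 2 * √T.card := by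
    rw [integral_const_mul]
    have := integral_exp_mul_Ioi (a := -(1 / 2 : ℝ)) (by norm_num) 0
    simp only [neg_mul] at this
    rw [this]
    norm_num
    ring
  rw [← h2, ofReal_integral_eq_lintegral_ofReal hint
    (Eventually.of_forall fun _ => by positivity)]
  refine setLIntegral_mono' measurableSet_Ioi fun t ht => ?_
  rw [← ofReal_integral_eq_lintegral_ofReal]
  · exact ENNReal.ofReal_le_ofReal
      (integral_abs_card_sub_exp_le hZ hind fun i hi => htail i hi t (le_of_lt ht))
  · refine Integrable.of_bound (C := T.card + T.card * Real.exp (-t))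
      (hm.comp (measurable_id.prodMk measurable_const)).aestronglyMeasurable
      (Eventually.of_forall fun ω => ?_)
    rw [Real.norm_eq_abs, abs_abs]
    refine (abs_sub _ _).trans ?_
    rw [Nat.abs_cast, abs_of_nonneg (a := T.card * Real.exp (-t)) (by positivity)]
    gcongr
    exact Finset.filter_subset _ _
  · exact Eventually.of_forall fun _ => abs_nonneg _

end tailDevMean

/-! ### The standard exponential law and its samples. -/

instance isProbabilityMeasure_expMeasure_one : IsProbabilityMeasure (expMeasure 1) :=
  isProbabilityMeasure_expMeasure one_pos

instance isProbabilityMeasure_expSample (m : ℕ) : IsProbabilityMeasure (expSample m) := by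
  unfold expSample
  infer_instance

lemma expMeasure_one_real_Ioi {t : ℝ} (ht : 0 ≤ t) :
    (expMeasure 1).real (Set.Ioi t) = Real.exp (-t) := by
  have h := cdf_expMeasure_eq one_pos t
  rw [if_pos ht, cdf_eq_real, one_mul] at h
  rw [← Set.compl_Iic, probReal_compl_eq_one_sub measurableSet_Iic, h]
  ring

lemma expMeasure_one_Iio_zero : expMeasure 1 (Set.Iio 0) = 0 := by
  have h := cdf_expMeasure_eq one_pos 0
  rw [if_pos le_rfl, cdf_eq_real] at h
  norm_num at h
  rw [measureReal_eq_zero_iff] at h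
  exact measure_mono_null Set.Iio_subset_Iic_self h

lemma expMeasure_one_Ioo_pos {a b : ℝ} (ha : 0 ≤ a) (hab : a < b) :
    0 < expMeasure 1 (Set.Ioo a b) := by
  obtain ⟨c, hac, hcb⟩ := exists_between hab
  refine lt_of_lt_of_le ?_ (measure_mono (Set.Ioc_subset_Ioo_right hcb))
  have h : (expMeasure 1).real (Set.Ioc a c) = Real.exp (-a) - Real.exp (-c) := by
    rw [← Set.Ioi_sdiff_Ioi, measureReal_sdiff (Set.Ioi_subset_Ioi hac.le) measurableSet_Ioi,
      expMeasure_one_real_Ioi ha, expMeasure_one_real_Ioi (ha.trans hac.le)]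
  have h2 : 0 < (expMeasure 1).real (Set.Ioc a c) := by
    rw [h, sub_pos, Real.exp_lt_exp]
    linarith
  exact (ENNReal.toReal_pos_iff.1 h2).1

lemma lintegral_expMeasure_one : ∫⁻ x, ENNReal.ofReal x ∂(expMeasure 1) = 1 := by
  have hnn : 0 ≤ᵐ[expMeasure 1] fun x : ℝ => x := by
    rw [EventuallyLE, ae_iff]
    convert expMeasure_one_Iio_zero using 2
    ext x
    simp
  rw [lintegral_eq_lintegral_meas_lt _ hnn aemeasurable_id]
  have h : ∀ t ∈ Set.Ioi (0 : ℝ), expMeasure 1 {a | t < a} = ENNReal.ofReal (Real.exp (-t)) := by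
    intro t ht
    rw [← expMeasure_one_real_Ioi (le_of_lt ht), ofReal_measureReal]
    rfl
  rw [setLIntegral_congr_fun measurableSet_Ioi h, ← ofReal_integral_eq_lintegral_ofReal,
    integral_exp_neg_Ioi_zero, ENNReal.ofReal_one]
  · simpa [IntegrableOn] using exp_neg_integrableOn_Ioi 0 one_pos
  · exact Eventually.of_forall fun _ => (Real.exp_pos _).le

section expSample

variable {m : ℕ}

lemma expSample_eq_withDensity :
    expSample m = volume.withDensity
      (fun z : Fin m → ℝ => ENNReal.ofReal (∏ i, exponentialPDFReal 1 (z i))) := by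
  unfold expSample
  refine Measure.pi_eq fun s hs => ?_
  have hpm : Measurable (exponentialPDFReal 1) := measurable_exponentialPDFReal 1
  have h0 : ∀ x, 0 ≤ exponentialPDFReal 1 x := exponentialPDFReal_nonneg one_pos
  have hint : Integrable (exponentialPDFReal 1) := by
    refine ⟨hpm.aestronglyMeasurable, ?_⟩
    rw [hasFiniteIntegral_iff_ofReal (Eventually.of_forall h0)]
    have := lintegral_exponentialPDF_eq_one one_pos
    unfold exponentialPDF at this
    rw [this]
    exact ENNReal.one_lt_top
  have hprod : ∀ z : Fin m → ℝ, (Set.univ.pi s).indicator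
      (fun z : Fin m → ℝ => ENNReal.ofReal (∏ i, exponentialPDFReal 1 (z i))) z
      = ENNReal.ofReal (∏ i, (s i).indicator (exponentialPDFReal 1) (z i)) := by
    intro z
    by_cases hz : z ∈ Set.univ.pi s
    · rw [Set.indicator_of_mem hz]
      congr 1
      refine Finset.prod_congr rfl fun i _ => ?_
      rw [Set.indicator_of_mem (hz i (Set.mem_univ i))]
    · rw [Set.indicator_of_notMem hz]
      simp only [Set.mem_pi, Set.mem_univ, true_implies, not_forall] at hz
      obtain ⟨i, hi⟩ := hz
      rw [Finset.prod_eq_zero (Finset.mem_univ i) (Set.indicator_of_notMem hi _),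
        ENNReal.ofReal_zero]
  have hind0 : ∀ i x, 0 ≤ (s i).indicator (exponentialPDFReal 1) x := fun i x =>
    Set.indicator_nonneg (fun x _ => h0 x) x
  rw [withDensity_apply _ (MeasurableSet.univ_pi hs),
    ← lintegral_indicator (MeasurableSet.univ_pi hs), lintegral_congr hprod,
    ← ofReal_integral_eq_lintegral_ofReal, integral_fintype_prod_volume_eq_prod
      (f := fun i x => (s i).indicator (exponentialPDFReal 1) x),
    ENNReal.ofReal_prod_of_nonneg fun i _ => integral_nonneg (hind0 i)]
  · refine Finset.prod_congr rfl fun i _ => ?_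
    rw [ofReal_integral_eq_lintegral_ofReal (hint.indicator (hs i))
      (Eventually.of_forall (hind0 i))]
    change _ = volume.withDensity (exponentialPDF 1) (s i)
    rw [withDensity_apply _ (hs i), ← lintegral_indicator (hs i)]
    refine lintegral_congr fun x => ?_
    by_cases hx : x ∈ s i
    · simp [hx, exponentialPDF]
    · simp [hx]
  · exact Integrable.fintype_prod (f := fun i x => (s i).indicator (exponentialPDFReal 1) x)
      fun i => hint.indicator (hs i)
  · exact Eventually.of_forall fun z => Finset.prod_nonneg fun i _ => hind0 i _

/-- On the orthant the density is a function of the coordinate sum alone, which is what makes the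
conditional means linear. -/
lemma expSample_eq_withDensity_restrict :
    expSample m = (volume.restrict (Set.Ici (0 : Fin m → ℝ))).withDensity
      (fun z => ENNReal.ofReal (Real.exp (-∑ i, z i))) := by
  rw [expSample_eq_withDensity, ← withDensity_indicator measurableSet_Ici]
  congr 1
  ext z
  by_cases hz : z ∈ Set.Ici (0 : Fin m → ℝ)
  · rw [Set.indicator_of_mem hz, ← Finset.sum_neg_distrib, Real.exp_sum]
    congr 1
    refine Finset.prod_congr rfl fun i _ => ?_
    have : 0 ≤ z i := hz i
    simp [exponentialPDFReal, gammaPDFReal, this]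
  · rw [Set.indicator_of_notMem hz]
    simp only [Set.mem_Ici, Pi.le_def, not_forall, not_le] at hz
    obtain ⟨i, hi⟩ := hz
    rw [Finset.prod_eq_zero (Finset.mem_univ i), ENNReal.ofReal_zero]
    have : ¬ (0 ≤ z i) := not_le.2 hi
    simp [exponentialPDFReal, gammaPDFReal, this]

/-! ### Homogeneous functions of an exponential sample. -/

/-- The image under the coordinate sum of the measure with density `f` on the positive orthant. -/
noncomputable def radialMeasure (f : (Fin m → ℝ) → ℝ) : Measure ℝ :=
  ((volume.restrict (Set.Ici (0 : Fin m → ℝ))).withDensity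
    (fun z => ENNReal.ofReal (f z))).map (fun z => ∑ i, z i)

lemma measurable_coordSum : Measurable (fun z : Fin m → ℝ => ∑ i, z i) := by fun_prop

lemma radialMeasure_apply (f : (Fin m → ℝ) → ℝ) {B : Set ℝ} (hB : MeasurableSet B) :
    radialMeasure f B = ∫⁻ z : Fin m → ℝ,
      (Set.Ici 0 ∩ {z | ∑ i, z i ∈ B}).indicator (fun z => ENNReal.ofReal (f z)) z := by
  have hB' : MeasurableSet {z : Fin m → ℝ | ∑ i, z i ∈ B} := measurable_coordSum hB
  rw [radialMeasure, Measure.map_apply measurable_coordSum hB,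
    withDensity_apply _ (measurable_coordSum hB), Measure.restrict_restrict
      (measurable_coordSum hB), lintegral_indicator (measurableSet_Ici.inter hB'),
    Set.inter_comm]
  rfl

lemma radialMeasure_Iic_of_nonpos {f : (Fin m → ℝ) → ℝ}
    (hf : ∀ a : ℝ, 0 ≤ a → ∀ z, f (a • z) = a * f z) {a : ℝ} (ha : a ≤ 0) :
    radialMeasure f (Set.Iic a) = 0 := by
  rw [radialMeasure_apply f measurableSet_Iic]
  refine (lintegral_congr fun z => ?_).trans lintegral_zero
  by_cases hz : z ∈ Set.Ici 0 ∩ {z : Fin m → ℝ | ∑ i, z i ∈ Set.Iic a}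
  · have h0 : ∀ i, 0 ≤ z i := hz.1
    have h1 : ∑ i, z i = 0 := le_antisymm (le_trans hz.2 ha) (Finset.sum_nonneg fun i _ => h0 i)
    have h2 : z = 0 := by
      ext i
      exact (Finset.sum_eq_zero_iff_of_nonneg fun i _ => h0 i).1 h1 i (Finset.mem_univ i)
    rw [Set.indicator_of_mem hz, h2]
    have := hf 0 le_rfl 0
    rw [smul_zero, zero_mul] at this
    rw [this, ENNReal.ofReal_zero]
  · rw [Set.indicator_of_notMem hz]

/-- Scaling by `a` contributes `a ^ m` from Lebesgue measure and one more factor `a` from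
homogeneity. The measure is therefore known up to a constant, which gives the proportionality below.
-/
lemma radialMeasure_Iic {f : (Fin m → ℝ) → ℝ} (hfm : Measurable f)
    (hf : ∀ a : ℝ, 0 ≤ a → ∀ z, f (a • z) = a * f z) {a : ℝ} (ha : 0 < a) :
    radialMeasure f (Set.Iic a) = ENNReal.ofReal (a ^ (m + 1)) * radialMeasure f (Set.Iic 1) := by
  set h : ℝ → (Fin m → ℝ) → ENNReal := fun b => (Set.Ici 0 ∩
    {z | ∑ i, z i ∈ Set.Iic b}).indicator (fun z => ENNReal.ofReal (f z)) with hh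
  have hmeas : ∀ b, Measurable (h b) := fun b =>
    hfm.ennreal_ofReal.indicator (measurableSet_Ici.inter (measurable_coordSum measurableSet_Iic))
  have h1 : ∀ z, h a (a • z) = ENNReal.ofReal a * h 1 z := by
    intro z
    have hiff : a • z ∈ Set.Ici 0 ∩ {z : Fin m → ℝ | ∑ i, z i ∈ Set.Iic a} ↔
        z ∈ Set.Ici 0 ∩ {z : Fin m → ℝ | ∑ i, z i ∈ Set.Iic 1} := by
      simp only [Set.mem_inter_iff, Set.mem_Ici, Set.mem_ofPred_eq, Set.mem_Iic, Pi.le_def,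
        Pi.zero_apply, Pi.smul_apply, smul_eq_mul, ← Finset.mul_sum]
      refine and_congr (forall_congr' fun i => by rw [mul_nonneg_iff_of_pos_left ha]) ?_
      rw [mul_le_iff_le_one_right ha]
    simp only [hh]
    by_cases hz : z ∈ Set.Ici 0 ∩ {z : Fin m → ℝ | ∑ i, z i ∈ Set.Iic 1}
    · rw [Set.indicator_of_mem hz, Set.indicator_of_mem (hiff.2 hz), hf a ha.le,
        ENNReal.ofReal_mul ha.le]
    · rw [Set.indicator_of_notMem hz, Set.indicator_of_notMem (fun h => hz (hiff.1 h)), mul_zero]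
  have h2 : ∫⁻ z, h a (a • z) = ENNReal.ofReal (a ^ m)⁻¹ * ∫⁻ z, h a z := by
    rw [← lintegral_map (hmeas a) (measurable_const_smul a), Measure.map_addHaar_smul _ ha.ne',
      lintegral_smul_measure]
    simp [abs_of_pos ha]
  rw [radialMeasure_apply f measurableSet_Iic, radialMeasure_apply f measurableSet_Iic]
  change ∫⁻ z, h a z = _ * ∫⁻ z, h 1 z
  simp_rw [h1] at h2
  rw [lintegral_const_mul _ (hmeas 1)] at h2
  rw [pow_succ, ENNReal.ofReal_mul (by positivity), mul_assoc, h2, ← mul_assoc,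
    ← ENNReal.ofReal_mul (by positivity), mul_inv_cancel₀ (by positivity), ENNReal.ofReal_one,
    one_mul]

/-- Radial measures of homogeneous functions are proportional. -/
lemma radialMeasure_smul_comm {f g : (Fin m → ℝ) → ℝ} (hfm : Measurable f) (hgm : Measurable g)
    (hf : ∀ a : ℝ, 0 ≤ a → ∀ z, f (a • z) = a * f z)
    (hg : ∀ a : ℝ, 0 ≤ a → ∀ z, g (a • z) = a * g z)
    (hfK : radialMeasure f (Set.Iic 1) ≠ ⊤) (hgK : radialMeasure g (Set.Iic 1) ≠ ⊤) :
    radialMeasure g (Set.Iic 1) • radialMeasure f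
      = radialMeasure f (Set.Iic 1) • radialMeasure g := by
  have hfin : ∀ {f : (Fin m → ℝ) → ℝ}, Measurable f →
      (∀ a : ℝ, 0 ≤ a → ∀ z, f (a • z) = a * f z) → radialMeasure f (Set.Iic 1) ≠ ⊤ →
      ∀ a, radialMeasure f (Set.Iic a) ≠ ⊤ := by
    intro f hfm hf hfK a
    rcases le_or_gt a 0 with ha | ha
    · simp [radialMeasure_Iic_of_nonpos hf ha]
    · rw [radialMeasure_Iic hfm hf ha]
      exact ENNReal.mul_ne_top ENNReal.ofReal_ne_top hfK
  have hIic : ∀ a, radialMeasure g (Set.Iic 1) * radialMeasure f (Set.Iic a)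
      = radialMeasure f (Set.Iic 1) * radialMeasure g (Set.Iic a) := by
    intro a
    rcases le_or_gt a 0 with ha | ha
    · simp [radialMeasure_Iic_of_nonpos hf ha, radialMeasure_Iic_of_nonpos hg ha]
    · rw [radialMeasure_Iic hfm hf ha, radialMeasure_Iic hgm hg ha]
      ring
  refine Measure.ext_of_Ioc' _ _ (fun a b _ => ?_) fun a b hab => ?_
  · refine ne_top_of_le_ne_top ?_ (measure_mono Set.Ioc_subset_Iic_self)
    rw [Measure.smul_apply, smul_eq_mul]
    exact ENNReal.mul_ne_top hgK (hfin hfm hf hfK b)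
  · rw [← Set.Iic_sdiff_Iic, Measure.smul_apply, Measure.smul_apply, smul_eq_mul, smul_eq_mul,
      measure_sdiff (Set.Iic_subset_Iic.2 hab.le) measurableSet_Iic.nullMeasurableSet
        (hfin hfm hf hfK a),
      measure_sdiff (Set.Iic_subset_Iic.2 hab.le) measurableSet_Iic.nullMeasurableSet
        (hfin hgm hg hgK a), ENNReal.mul_sub (fun _ _ => hgK), ENNReal.mul_sub (fun _ _ => hfK),
      hIic, hIic]

/-- The exponential weight factors through the sum, so it can be put on the line after pushing `f`
forward. -/
lemma setLIntegral_expSample_eq {f : (Fin m → ℝ) → ℝ} (hfm : Measurable f) {B : Set ℝ}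
    (hB : MeasurableSet B) :
    ∫⁻ z in (fun z : Fin m → ℝ => ∑ i, z i) ⁻¹' B, ENNReal.ofReal (f z) ∂(expSample m)
      = ∫⁻ x in B, ENNReal.ofReal (Real.exp (-x)) ∂(radialMeasure f) := by
  have hd : Measurable fun x : ℝ => ENNReal.ofReal (Real.exp (-x)) := by fun_prop
  have hd' : Measurable fun z : Fin m → ℝ => ENNReal.ofReal (Real.exp (-∑ i, z i)) := by fun_prop
  rw [expSample_eq_withDensity_restrict, radialMeasure,
    setLIntegral_map hB hd measurable_coordSum,
    setLIntegral_withDensity_eq_setLIntegral_mul _ hd' hfm.ennreal_ofReal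
      (measurable_coordSum hB),
    setLIntegral_withDensity_eq_setLIntegral_mul _ hfm.ennreal_ofReal hd'
      (measurable_coordSum hB)]
  refine lintegral_congr fun z => ?_
  simp only [Pi.mul_apply]
  ring

lemma ae_expSample_nonneg : ∀ᵐ z ∂(expSample m), ∀ i, 0 ≤ z i := by
  rw [expSample_eq_withDensity_restrict]
  refine (withDensity_absolutelyContinuous _ _).ae_le ?_
  filter_upwards [ae_restrict_mem measurableSet_Ici] with z hz
  exact hz

lemma lintegral_sum_expSample :
    ∫⁻ z, ENNReal.ofReal (∑ i, z i) ∂(expSample m) = m := by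
  have h : ∫⁻ z, ENNReal.ofReal (∑ i, z i) ∂(expSample m)
      = ∫⁻ z, ∑ i, ENNReal.ofReal (z i) ∂(expSample m) := by
    refine lintegral_congr_ae ?_
    filter_upwards [ae_expSample_nonneg] with z hz
    exact ENNReal.ofReal_sum_of_nonneg fun i _ => hz i
  rw [h, lintegral_finsetSum _ fun i _ => by fun_prop]
  have h2 : ∀ i : Fin m, ∫⁻ z, ENNReal.ofReal (z i) ∂(expSample m) = 1 := by
    intro i
    rw [← lintegral_expMeasure_one]
    exact (measurePreserving_eval (fun _ : Fin m => expMeasure 1) i).lintegral_comp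
      (by fun_prop)
  simp [h2]

lemma integrable_sum_expSample : Integrable (fun z : Fin m → ℝ => ∑ i, z i) (expSample m) := by
  refine ⟨measurable_coordSum.aestronglyMeasurable, ?_⟩
  rw [hasFiniteIntegral_iff_ofReal, lintegral_sum_expSample]
  · exact ENNReal.natCast_lt_top m
  · filter_upwards [ae_expSample_nonneg] with z hz
    exact Finset.sum_nonneg fun i _ => hz i

lemma integral_sum_expSample : ∫ z, ∑ i, z i ∂(expSample m) = m := by
  rw [integral_eq_lintegral_of_nonneg_ae _ measurable_coordSum.aestronglyMeasurable,
    lintegral_sum_expSample, ENNReal.toReal_natCast]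
  filter_upwards [ae_expSample_nonneg] with z hz
  exact Finset.sum_nonneg fun i _ => hz i

/-- A homogeneous function of independent exponential variables, divided by their sum, is
uncorrelated with every event determined by the sum. -/
lemma setIntegral_expSample_of_homogeneous {f : (Fin m → ℝ) → ℝ} (hfm : Measurable f)
    (hf : ∀ a : ℝ, 0 ≤ a → ∀ z, f (a • z) = a * f z) (hf0 : ∀ z, (∀ i, 0 ≤ z i) → 0 ≤ f z)
    (hf1 : ∀ z, (∀ i, 0 ≤ z i) → f z ≤ ∑ i, z i) {B : Set ℝ} (hB : MeasurableSet B) :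
    m * ∫ z in (fun z : Fin m → ℝ => ∑ i, z i) ⁻¹' B, f z ∂(expSample m)
      = (∫ z, f z ∂(expSample m))
        * ∫ z in (fun z : Fin m → ℝ => ∑ i, z i) ⁻¹' B, ∑ i, z i ∂(expSample m) := by
  set g : (Fin m → ℝ) → ℝ := fun z => ∑ i, z i with hg
  have hgm : Measurable g := measurable_coordSum
  have hgh : ∀ a : ℝ, 0 ≤ a → ∀ z, g (a • z) = a * g z := fun a _ z => by
    simp [hg, Finset.mul_sum]
  have hg0 : ∀ z, (∀ i, 0 ≤ z i) → 0 ≤ g z := fun z hz => Finset.sum_nonneg fun i _ => hz i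
  have hle : ∀ {B : Set ℝ}, MeasurableSet B → radialMeasure f B ≤ radialMeasure g B := by
    intro B hB
    rw [radialMeasure_apply f hB, radialMeasure_apply g hB]
    refine lintegral_mono fun z => ?_
    refine Set.indicator_le_indicator' fun hz => ENNReal.ofReal_le_ofReal (hf1 z hz.1)
  have hgK : radialMeasure g (Set.Iic 1) ≠ ⊤ := by
    have h1 := setLIntegral_expSample_eq hgm (measurableSet_Iic (a := (1 : ℝ)))
    have h2 : ENNReal.ofReal (Real.exp (-1)) * radialMeasure g (Set.Iic 1)
        ≤ ∫⁻ x in Set.Iic 1, ENNReal.ofReal (Real.exp (-x)) ∂(radialMeasure g) := by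
      rw [← setLIntegral_const]
      refine setLIntegral_mono' measurableSet_Iic fun x hx => ENNReal.ofReal_le_ofReal ?_
      have : x ≤ 1 := hx
      gcongr
    rw [← h1] at h2
    have h3 := h2.trans (setLIntegral_le_lintegral _ _)
    rw [lintegral_sum_expSample] at h3
    intro htop
    rw [htop, ENNReal.mul_top (by simp [Real.exp_pos])] at h3
    exact absurd h3 (by simp)
  have hfK : radialMeasure f (Set.Iic 1) ≠ ⊤ := ne_top_of_le_ne_top hgK (hle measurableSet_Iic)
  have hcomm := radialMeasure_smul_comm hfm hgm hf hgh hfK hgK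
  have hprop : ∀ {B : Set ℝ}, MeasurableSet B →
      radialMeasure g (Set.Iic 1) * ∫⁻ z in g ⁻¹' B, ENNReal.ofReal (f z) ∂(expSample m)
      = radialMeasure f (Set.Iic 1) * ∫⁻ z in g ⁻¹' B, ENNReal.ofReal (g z) ∂(expSample m) := by
    intro B hB
    rw [setLIntegral_expSample_eq hfm hB, setLIntegral_expSample_eq hgm hB,
      ← smul_eq_mul, ← lintegral_smul_measure, ← Measure.restrict_smul, hcomm,
      Measure.restrict_smul, lintegral_smul_measure, smul_eq_mul]
  have huniv := hprop MeasurableSet.univ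
  rw [Set.preimage_univ, setLIntegral_univ, setLIntegral_univ, lintegral_sum_expSample] at huniv
  have hB' := hprop hB
  have hreal : ∀ {h : (Fin m → ℝ) → ℝ} (S : Set (Fin m → ℝ)), Measurable h →
      (∀ z, (∀ i, 0 ≤ z i) → 0 ≤ h z) → ∫ z in S, h z ∂(expSample m)
        = (∫⁻ z in S, ENNReal.ofReal (h z) ∂(expSample m)).toReal := by
    intro h S hm h0
    refine integral_eq_lintegral_of_nonneg_ae ?_ hm.aestronglyMeasurable
    exact ae_restrict_of_ae (ae_expSample_nonneg.mono fun z hz => h0 z hz)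
  have e1 := congrArg ENNReal.toReal huniv
  have e2 := congrArg ENNReal.toReal hB'
  rw [ENNReal.toReal_mul, ENNReal.toReal_mul] at e1 e2
  rw [← hreal _ hfm hf0, ← hreal _ hgm hg0] at e2
  rw [← setLIntegral_univ, ← hreal _ hfm hf0, setIntegral_univ, ENNReal.toReal_natCast] at e1
  -- The constant of proportionality can be cancelled unless it vanishes; by scaling it vanishes
  -- only if the mean of the sum is zero, that is, for `m = 0`.
  rcases eq_or_ne (radialMeasure g (Set.Iic 1)) 0 with hz | hz
  · have hf_zero : radialMeasure f (Set.Iic 1) = 0 :=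
      le_antisymm ((hle measurableSet_Iic).trans_eq hz) zero_le
    have hnull : radialMeasure g = 0 := by
      have hcover : (⋃ k : ℕ, Set.Iic (k : ℝ)) = Set.univ :=
        Set.eq_univ_of_forall fun x => Set.mem_iUnion.2 (exists_nat_ge x)
      rw [← Measure.measure_univ_eq_zero, ← hcover]
      refine measure_iUnion_null fun k => ?_
      rcases Nat.eq_zero_or_pos k with rfl | hk
      · exact radialMeasure_Iic_of_nonpos hgh (by simp)
      · rw [radialMeasure_Iic hgm hgh (by exact_mod_cast hk), hz, mul_zero]
    have h0 := setLIntegral_expSample_eq hgm MeasurableSet.univ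
    rw [hnull, Set.preimage_univ, setLIntegral_univ] at h0
    rw [lintegral_sum_expSample] at h0
    simp only [Measure.restrict_zero, lintegral_zero_measure, Nat.cast_eq_zero] at h0
    subst h0
    have hf00 : ∀ z, f z = 0 := fun z => by
      have := hf 0 le_rfl z
      rwa [zero_smul, zero_mul, Subsingleton.elim 0 z] at this
    simp [hf00]
  · have hpos : (radialMeasure g (Set.Iic 1)).toReal ≠ 0 := ENNReal.toReal_ne_zero.2 ⟨hz, hgK⟩
    apply mul_left_cancel₀ hpos
    calc (radialMeasure g (Set.Iic 1)).toReal * (m * ∫ z in g ⁻¹' B, f z ∂(expSample m))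
        = m * ((radialMeasure g (Set.Iic 1)).toReal * ∫ z in g ⁻¹' B, f z ∂(expSample m)) := by
          ring
      _ = ((radialMeasure f (Set.Iic 1)).toReal * m) * ∫ z in g ⁻¹' B, g z ∂(expSample m) := by
          rw [e2]
          ring
      _ = _ := by
          rw [← e1]
          ring

end expSample

/-! ### The conditional mean under the null hypothesis. -/

section nullCondMean

variable {m : ℕ}

/-- The slope of the linear function `s ↦ E(T_j | T_m = s)`. -/
noncomputable def nullSlope (m j : ℕ) : ℝ := (∫ z, windowSum (decr z) 0 j ∂(expSample m)) / m

lemma windowSum_decr_nonneg {z : Fin m → ℝ} (hz : ∀ i, 0 ≤ z i) (k j : ℕ) :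
    0 ≤ windowSum (decr z) k j :=
  windowSum_nonneg (fun i => hz (Tuple.sort (fun l => -z l) i)) k j

lemma windowSum_decr_le_sum {z : Fin m → ℝ} (hz : ∀ i, 0 ≤ z i) {j : ℕ} (hj : j ≤ m) :
    windowSum (decr z) 0 j ≤ ∑ i, z i := by
  rw [← windowSum_decr_full]
  exact windowSum_mono_length (fun i => hz (Tuple.sort (fun l => -z l) i)) 0 hj

lemma integrable_windowSum_decr {j : ℕ} (hj : j ≤ m) :
    Integrable (fun z : Fin m → ℝ => windowSum (decr z) 0 j) (expSample m) := by
  refine integrable_sum_expSample.mono' (measurable_windowSum_decr 0 j).aestronglyMeasurable ?_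
  filter_upwards [ae_expSample_nonneg] with z hz
  rw [Real.norm_eq_abs, abs_of_nonneg (windowSum_decr_nonneg hz 0 j)]
  exact windowSum_decr_le_sum hz hj

lemma nullSlope_nonneg (m j : ℕ) : 0 ≤ nullSlope m j := by
  refine div_nonneg (integral_nonneg_of_ae ?_) (Nat.cast_nonneg m)
  filter_upwards [ae_expSample_nonneg] with z hz
  exact windowSum_decr_nonneg hz 0 j

lemma nullSlope_le_one {j : ℕ} (hj : j ≤ m) : nullSlope m j ≤ 1 := by
  refine div_le_one_of_le₀ ?_ (Nat.cast_nonneg m)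
  rw [← integral_sum_expSample (m := m)]
  refine integral_mono_ae (integrable_windowSum_decr hj) integrable_sum_expSample ?_
  filter_upwards [ae_expSample_nonneg] with z hz
  exact windowSum_decr_le_sum hz hj

lemma lintegral_tailDev_expSample_le :
    ∫⁻ z, ENNReal.ofReal (tailDev Finset.univ z) ∂(expSample m) ≤ ENNReal.ofReal (2 * √m) := by
  have h := lintegral_tailDev_le (P := expSample m) (T := (Finset.univ : Finset (Fin m)))
    (Z := fun i z => z i) (fun i _ => measurable_pi_apply i)
    (fun i _ j _ hij => (iIndepFun_pi (X := fun _ x => x)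
      (μ := fun _ : Fin m => expMeasure 1) fun _ => aemeasurable_id).indepFun hij)
    (fun i _ t ht => by
      rw [← expMeasure_one_real_Ioi ht, measureReal_def, measureReal_def]
      congr 1
      exact (measurePreserving_eval (fun _ : Fin m => expMeasure 1) i).measure_preimage
        measurableSet_Ioi.nullMeasurableSet)
  rwa [Finset.card_univ, Fintype.card_fin] at h

/-- The pathwise bound by `tailDev` is averaged, which avoids computing the means of exponential
order statistics. -/
lemma abs_nullSlope_sub_topMean_le {j : ℕ} (hm : 0 < m) (hj : j ≤ m) :
    |nullSlope m j - topMean (j / m)| ≤ 2 / √m := by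
  have hm' : (0 : ℝ) < m := by exact_mod_cast hm
  have hmeas : Measurable fun z : Fin m → ℝ => tailDev Finset.univ z :=
    measurable_tailDev (T := Finset.univ) (Z := fun (i : Fin m) (z : Fin m → ℝ) => z i)
      fun i _ => measurable_pi_apply i
  have hint : Integrable (fun z : Fin m → ℝ => tailDev Finset.univ z) (expSample m) := by
    refine ⟨hmeas.aestronglyMeasurable, ?_⟩
    rw [hasFiniteIntegral_iff_ofReal (Eventually.of_forall fun z => tailDev_nonneg _ _)]
    exact lintegral_tailDev_expSample_le.trans_lt ENNReal.ofReal_lt_top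
  have hle : ∫ z, tailDev Finset.univ z ∂(expSample m) ≤ 2 * √m := by
    rw [integral_eq_lintegral_of_nonneg_ae (Eventually.of_forall fun z => tailDev_nonneg _ _)
      hmeas.aestronglyMeasurable]
    exact ENNReal.toReal_le_of_le_ofReal (by positivity) lintegral_tailDev_expSample_le
  have h1 : nullSlope m j - topMean (j / m)
      = (∫ z, (windowSum (decr z) 0 j - m * topMean (j / m)) ∂(expSample m)) / m := by
    rw [integral_sub (integrable_windowSum_decr hj) (integrable_const _), integral_const]
    simp only [probReal_univ, one_smul, nullSlope]
    field_simp
  have h2 : |∫ z, (windowSum (decr z) 0 j - m * topMean (j / m)) ∂(expSample m)| ≤ 2 * √m := by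
    refine abs_integral_le_integral_abs.trans (le_trans ?_ hle)
    refine integral_mono_ae
      ((integrable_windowSum_decr hj).sub (integrable_const _)).abs hint ?_
    filter_upwards [ae_expSample_nonneg] with z hz
    have := abs_windowSum_sub_topMean_le (antitone_decr z)
      (fun i => hz (Tuple.sort (fun l => -z l) i)) (k := 0) (j := j) (by omega)
    simpa [tailDev_decr] using this
  rw [h1, abs_div, abs_of_pos hm', div_le_div_iff₀ hm' (Real.sqrt_pos.2 hm')]
  calc _ ≤ 2 * √m * √m := by gcongr
    _ = 2 * m := by rw [mul_assoc, Real.mul_self_sqrt hm'.le]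

lemma isNullCondMean_nullSlope {j : ℕ} (hm : 0 < m) (hj : j ≤ m) :
    IsNullCondMean m j (fun s => s * nullSlope m j) := by
  refine ⟨by fun_prop, ?_⟩
  have hfull : (fun z : Fin m → ℝ => windowSum (decr z) 0 m) = fun z => ∑ i, z i := by
    funext z
    exact windowSum_decr_full z
  simp_rw [windowSum_decr_full]
  have hle : MeasurableSpace.comap (fun z : Fin m → ℝ => ∑ i, z i) inferInstance
      ≤ MeasurableSpace.pi := measurable_coordSum.comap_le
  have hm' : (m : ℝ) ≠ 0 := by exact_mod_cast hm.ne'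
  refine ae_eq_condExp_of_forall_setIntegral_eq hle (integrable_windowSum_decr hj)
    (fun s _ _ => (integrable_sum_expSample.mul_const _).integrableOn) ?_ ?_
  · rintro s ⟨B, hB, rfl⟩ -
    have h := setIntegral_expSample_of_homogeneous (measurable_windowSum_decr (n := m) 0 j)
      (fun a ha z => windowSum_decr_smul ha z 0 j) (fun z hz => windowSum_decr_nonneg hz 0 j)
      (fun z hz => windowSum_decr_le_sum hz hj) hB
    rw [integral_mul_const]
    apply mul_left_cancel₀ hm'
    rw [h]
    unfold nullSlope
    field_simp
  · exact ((comap_measurable _).mul_const _).aestronglyMeasurable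

lemma expSample_sum_Ioo_pos (hm : 0 < m) {a b : ℝ} (ha : 0 ≤ a) (hab : a < b) :
    0 < expSample m {z | ∑ i, z i ∈ Set.Ioo a b} := by
  have hm' : (0 : ℝ) < m := by exact_mod_cast hm
  have : Nonempty (Fin m) := ⟨⟨0, hm⟩⟩
  have h : 0 < expSample m (Set.univ.pi fun _ => Set.Ioo (a / m) (b / m)) := by
    unfold expSample
    rw [Measure.pi_pi]
    refine CanonicallyOrderedAdd.prod_pos.2 fun i _ => ?_
    exact expMeasure_one_Ioo_pos (by positivity) (by gcongr)
  refine h.trans_le (measure_mono fun z hz => ?_)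
  have hz' : ∀ i, z i ∈ Set.Ioo (a / m) (b / m) := fun i => hz i (Set.mem_univ i)
  constructor
  · calc a = ∑ _i : Fin m, a / m := by simp; field_simp
      _ < ∑ i, z i := Finset.sum_lt_sum_of_nonempty Finset.univ_nonempty fun i _ => (hz' i).1
  · calc ∑ i, z i < ∑ _i : Fin m, b / m :=
        Finset.sum_lt_sum_of_nonempty Finset.univ_nonempty fun i _ => (hz' i).2
      _ = b := by simp; field_simp

/-- The sum charges every open interval of the half-line, so two continuous versions that agree
almost surely agree everywhere on it. This makes the choice in `nullCondMean` harmless. -/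
lemma IsNullCondMean.eqOn {j : ℕ} (hm : 0 < m) {g h : ℝ → ℝ} (hg : IsNullCondMean m j g)
    (hh : IsNullCondMean m j h) : Set.EqOn g h (Set.Ici 0) := by
  have hae : ∀ᵐ z ∂(expSample m), g (∑ i, z i) = h (∑ i, z i) := by
    filter_upwards [hg.2, hh.2] with z h1 h2
    rw [← windowSum_decr_full, h1, h2]
  intro s hs
  by_contra hne
  have hd : ContinuousWithinAt (fun x => g x - h x) (Set.Ici 0) s :=
    (hg.1 s hs).sub (hh.1 s hs)
  have hev : ∀ᶠ x in 𝓝[Set.Ici 0] s, g x - h x ≠ 0 := hd.eventually_ne (sub_ne_zero.2 hne)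
  rw [Metric.nhdsWithin_basis_ball.eventually_iff] at hev
  obtain ⟨r, hr, hball⟩ := hev
  have hpos := expSample_sum_Ioo_pos hm (a := s) (b := s + r) hs (by linarith)
  refine hpos.ne' (measure_mono_null (fun z hz => ?_) hae)
  have hz1 : s < ∑ i, z i := hz.1
  have hz2 : ∑ i, z i < s + r := hz.2
  have hs0 : 0 ≤ s := hs
  refine sub_ne_zero.1 (hball ⟨?_, ?_⟩)
  · rw [Metric.mem_ball, Real.dist_eq, abs_lt]
    constructor <;> linarith
  · exact hs0.trans hz1.le

lemma nullCondMean_eq {j : ℕ} (hm : 0 < m) (hj : j ≤ m) {s : ℝ} (hs : 0 ≤ s) :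
    nullCondMean m j s = s * nullSlope m j :=
  IsNullCondMean.eqOn hm (Classical.epsilon_spec ⟨_, isNullCondMean_nullSlope hm hj⟩)
    (isNullCondMean_nullSlope hm hj) hs

end nullCondMean

/-! ### Survival function under the von Mises conditions. -/

section extremes

/-- If the reciprocal hazard rate grows at most linearly, the survival function decays at least
polynomially in the natural scale. -/
lemma log_survival_sub_le {F : ℝ → ℝ} (hF1 : ∀ x, F x < 1) {x₀ C : ℝ} (hC : 0 < C)
    (hdiff : ∀ x, x₀ ≤ x → DifferentiableAt ℝ F x) (hpos : ∀ x, x₀ ≤ x → 0 < deriv F x)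
    (hgrow : ∀ b x, x₀ ≤ b → b ≤ x →
      (1 - F x) / deriv F x ≤ C * ((1 - F b) / deriv F b + (x - b)))
    {b x : ℝ} (hb : x₀ ≤ b) (hx : b ≤ x) :
    Real.log (1 - F x) - Real.log (1 - F b)
      ≤ -(1 / C) * Real.log (1 + (x - b) / ((1 - F b) / deriv F b)) := by
  set g := (1 - F b) / deriv F b with hg
  have hgpos : 0 < g := div_pos (sub_pos.2 (hF1 b)) (hpos b hb)
  have hda : ∀ y, b ≤ y → HasDerivAt
      (fun y => Real.log (1 - F y) + 1 / C * Real.log (g + (y - b)))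
      (-deriv F y / (1 - F y) + 1 / C * (1 / (g + (y - b)))) y := by
    intro y hy
    have h1 : HasDerivAt (fun y => 1 - F y) (-deriv F y) y :=
      (hdiff y (hb.trans hy)).hasDerivAt.const_sub 1
    have h2 : HasDerivAt (fun y => g + (y - b)) 1 y := ((hasDerivAt_id y).sub_const b).const_add g
    exact (h1.log (sub_pos.2 (hF1 y)).ne').add ((h2.log (by linarith)).const_mul _)
  -- The derivative of the log survival function is minus the hazard rate, and the growth hypothesis
  -- bounds that rate below by `1 / (C * (g + (y - b)))`.
  have hanti : AntitoneOn (fun y => Real.log (1 - F y) + 1 / C * Real.log (g + (y - b)))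
      (Set.Ici b) := by
    refine antitoneOn_of_deriv_nonpos (convex_Ici b)
      (fun y hy => (hda y hy).continuousAt.continuousWithinAt)
      (fun y hy => (hda y (interior_subset hy)).differentiableAt.differentiableWithinAt) ?_
    intro y hy
    have hy' : b ≤ y := interior_subset hy
    rw [(hda y hy').deriv]
    have hS := sub_pos.2 (hF1 y)
    have hD := hpos y (hb.trans hy')
    have hgy : 0 < g + (y - b) := by linarith
    have h3 := hgrow b y hb hy'
    rw [← hg, div_le_iff₀ hD] at h3
    have h4 : 1 / C * (1 / (g + (y - b))) ≤ deriv F y / (1 - F y) := by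
      rw [one_div_mul_one_div, div_le_div_iff₀ (by positivity) hS]
      linarith
    rw [neg_div]
    linarith
  have h := hanti (Set.mem_Ici.2 le_rfl) (Set.mem_Ici.2 hx) hx
  simp only [sub_self, add_zero] at h
  have h5 : 1 + (x - b) / g = (g + (x - b)) / g := by field_simp
  rw [h5, Real.log_div (by linarith) hgpos.ne']
  linarith

/-- Under either von Mises condition the reciprocal hazard rate grows at most linearly. -/
lemma exists_reciprocal_hazard_le {F : ℝ → ℝ} (hF1 : ∀ x, F x < 1)
    (h : VonMisesGumbel F ∨ VonMisesFrechet F) :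
    ∃ x₀ C : ℝ, 0 < C ∧ (∀ x, x₀ ≤ x → DifferentiableAt ℝ F x) ∧ (∀ x, x₀ ≤ x → 0 < deriv F x) ∧
      ∀ b x, x₀ ≤ b → b ≤ x →
        (1 - F x) / deriv F x ≤ C * ((1 - F b) / deriv F b + (x - b)) := by
  rcases h with ⟨hev, hlim⟩ | ⟨hev, a, ha, hlim⟩
  · have h2 := hlim.eventually (lt_mem_nhds (show (-2 : ℝ) < -1 by norm_num))
    obtain ⟨x₀, hx₀⟩ := eventually_atTop.1 (hev.and h2)
    refine ⟨x₀, 1, one_pos, fun x hx => (hx₀ x hx).1.1, fun x hx => (hx₀ x hx).1.2.2, ?_⟩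
    intro b x hb hbx
    have hda : ∀ y, x₀ ≤ y → HasDerivAt (fun y => (1 - F y) / deriv F y - y)
        ((-deriv F y * deriv F y - (1 - F y) * deriv (deriv F) y) / (deriv F y) ^ 2 - 1) y := by
      intro y hy
      obtain ⟨hd1, hd2, hp⟩ := (hx₀ y hy).1
      exact ((hd1.hasDerivAt.const_sub 1).div hd2.hasDerivAt hp.ne').sub (hasDerivAt_id y)
    have hanti : AntitoneOn (fun y => (1 - F y) / deriv F y - y) (Set.Ici x₀) := by
      refine antitoneOn_of_deriv_nonpos (convex_Ici x₀)
        (fun y hy => (hda y hy).continuousAt.continuousWithinAt)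
        (fun y hy => (hda y (interior_subset hy)).differentiableAt.differentiableWithinAt) ?_
      intro y hy
      have hy' : x₀ ≤ y := interior_subset hy
      rw [(hda y hy').deriv]
      obtain ⟨⟨-, -, hp⟩, h3⟩ := hx₀ y hy'
      have h4 : (-deriv F y * deriv F y - (1 - F y) * deriv (deriv F) y) / (deriv F y) ^ 2
          = -1 - (1 - F y) * deriv (deriv F) y / (deriv F y) ^ 2 := by field_simp
      rw [h4]
      linarith
    have := hanti (Set.mem_Ici.2 hb) (Set.mem_Ici.2 (hb.trans hbx)) hbx
    simp only at this
    linarith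
  · have h1 := hlim.eventually (lt_mem_nhds (show a / 2 < a by linarith))
    have h2 := hlim.eventually (gt_mem_nhds (show a < 2 * a by linarith))
    obtain ⟨x₀, hx₀⟩ := eventually_atTop.1 (((hev.and h1).and h2).and (eventually_gt_atTop 0))
    have hpos : ∀ x, x₀ ≤ x → 0 < deriv F x := by
      intro x hx
      obtain ⟨⟨⟨-, h3⟩, -⟩, h0⟩ := hx₀ x hx
      have h4 : 0 < x * deriv F x / (1 - F x) := lt_trans (by linarith) h3
      rw [div_pos_iff_of_pos_right (sub_pos.2 (hF1 x))] at h4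
      exact (mul_pos_iff_of_pos_left h0).1 h4
    -- The reciprocal hazard at `x` lies between `x / (2 * a)` and `2 * x / a`. The part `2 * b / a`
    -- of the upper bound is at most four times its value at `b`; the rest is `2 / a * (x - b)`.
    refine ⟨x₀, 2 / a + 4, by positivity, fun x hx => (hx₀ x hx).1.1.1, hpos, ?_⟩
    intro b x hb hbx
    obtain ⟨⟨⟨-, h3⟩, -⟩, h0⟩ := hx₀ x (hb.trans hbx)
    obtain ⟨⟨-, h4⟩, hb0⟩ := hx₀ b hb
    have hSx := sub_pos.2 (hF1 x)
    have hSb := sub_pos.2 (hF1 b)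
    have hDx := hpos x (hb.trans hbx)
    have hDb := hpos b hb
    rw [lt_div_iff₀ hSx] at h3
    rw [div_lt_iff₀ hSb] at h4
    have e1 : (1 - F x) / deriv F x ≤ 2 / a * x := by
      rw [div_le_iff₀ hDx, div_mul_eq_mul_div, div_mul_eq_mul_div, le_div_iff₀ ha]
      linarith
    have e2 : 2 / a * b ≤ 4 * ((1 - F b) / deriv F b) := by
      rw [← mul_div_assoc, le_div_iff₀ hDb, div_mul_eq_mul_div, div_mul_eq_mul_div, div_le_iff₀ ha]
      linarith
    have e3 : 0 ≤ 2 / a * ((1 - F b) / deriv F b) := by positivity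
    have e4 : 0 ≤ x - b := by linarith
    nlinarith

end extremes

/-! ### The law of the absolute errors. -/

section absCdf

variable {ν : Measure ℝ}

lemma monotone_absCdf : Monotone (absCdf ν) := monotone_cdf _

lemma absCdf_nonneg (x : ℝ) : 0 ≤ absCdf ν x := cdf_nonneg _ x

lemma tendsto_absCdf_atTop : Tendsto (absCdf ν) atTop (𝓝 1) := tendsto_cdf_atTop _

variable [IsProbabilityMeasure ν]

instance : IsProbabilityMeasure (ν.map (fun e => |e|)) :=
  Measure.isProbabilityMeasure_map measurable_norm.aemeasurable

lemma real_abs_le_eq_absCdf (x : ℝ) : ν.real {e | |e| ≤ x} = absCdf ν x := by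
  have hm : Measurable fun e : ℝ => |e| := measurable_norm
  rw [absCdf, cdf_eq_real, map_measureReal_apply hm measurableSet_Iic]
  rfl

lemma absCdf_of_neg {x : ℝ} (hx : x < 0) : absCdf ν x = 0 := by
  rw [← real_abs_le_eq_absCdf]
  have : {e : ℝ | |e| ≤ x} = ∅ := by
    ext e
    simpa using hx.trans_le (abs_nonneg e)
  rw [this, measureReal_empty]

lemma measure_singleton_of_continuous_cdf (h : Continuous (cdf ν)) (a : ℝ) : ν {a} = 0 := by
  rw [← measure_cdf ν, StieltjesFunction.measure_singleton,
    h.continuousAt.continuousWithinAt.leftLim_eq, sub_self, ENNReal.ofReal_zero]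

lemma absCdf_eq_max (h : Continuous (cdf ν)) (x : ℝ) :
    absCdf ν x = max 0 (cdf ν x - cdf ν (-x)) := by
  rcases lt_or_ge x 0 with hx | hx
  · have := monotone_cdf ν (show x ≤ -x by linarith)
    rw [absCdf_of_neg hx, max_eq_left (by linarith)]
  · have := monotone_cdf ν (show -x ≤ x by linarith)
    rw [max_eq_right (by linarith), ← real_abs_le_eq_absCdf, cdf_eq_real, cdf_eq_real,
      ← measureReal_sdiff (Set.Iic_subset_Iic.2 (by linarith)) measurableSet_Iic,
      Set.Iic_sdiff_Iic]
    have h1 : {e : ℝ | |e| ≤ x} = Set.Ioc (-x) x ∪ {-x} := by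
      ext e
      simp only [Set.mem_ofPred_eq, abs_le, Set.mem_union, Set.mem_Ioc, Set.mem_singleton_iff]
      constructor
      · rintro ⟨h2, h3⟩
        rcases h2.eq_or_lt with h4 | h4
        · exact Or.inr h4.symm
        · exact Or.inl ⟨h4, h3⟩
      · rintro (⟨h2, h3⟩ | rfl)
        · exact ⟨h2.le, h3⟩
        · exact ⟨le_rfl, by linarith⟩
    rw [h1]
    refine le_antisymm ?_ (measureReal_mono Set.subset_union_left)
    refine (measureReal_union_le _ _).trans_eq ?_
    rw [measureReal_def ν {-x}, measure_singleton_of_continuous_cdf h]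
    simp

lemma continuous_absCdf (h : Continuous (cdf ν)) : Continuous (absCdf ν) := by
  have : absCdf ν = fun x => max 0 (cdf ν x - cdf ν (-x)) := funext (absCdf_eq_max h)
  rw [this]
  exact continuous_const.max (h.sub (h.comp continuous_neg))

lemma exists_absCdf_eq (h : Continuous (cdf ν)) {p : ℝ} (hp : 0 ≤ p) (hp1 : p < 1) :
    ∃ x, absCdf ν x = p := by
  obtain ⟨y, hy⟩ := (tendsto_absCdf_atTop (ν := ν).eventually (lt_mem_nhds hp1)).exists
  refine mem_range_of_exists_le_of_exists_ge (continuous_absCdf h) ⟨-1, ?_⟩ ⟨y, hy.le⟩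
  rwa [absCdf_of_neg (by norm_num)]

/-- The transform of an absolute error is standard exponential. -/
lemma real_lt_neg_log_absCdf (h : Continuous (cdf ν)) (hF1 : ∀ x, absCdf ν x < 1) {t : ℝ}
    (ht : 0 ≤ t) : ν.real {e | t < -Real.log (1 - absCdf ν |e|)} = Real.exp (-t) := by
  set p := 1 - Real.exp (-t) with hp
  have hp0 : 0 ≤ p := sub_nonneg.2 (Real.exp_le_one_iff.2 (by linarith))
  have hp1 : p < 1 := by linarith [Real.exp_pos (-t)]
  obtain ⟨c, hc⟩ := exists_absCdf_eq h hp0 hp1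
  obtain ⟨y, hy⟩ := (tendsto_absCdf_atTop (ν := ν).eventually (lt_mem_nhds hp1)).exists
  -- The cdf may be flat at level `p`, so the right end of the flat piece serves as the quantile;
  -- this turns `F ≤ p` into a half-line.
  set A := {x | absCdf ν x ≤ p} with hA
  have hAbdd : BddAbove A := ⟨y, fun x hx => by
    by_contra hxy
    exact absurd (monotone_absCdf (le_of_not_ge hxy) : absCdf ν y ≤ absCdf ν x)
      (not_le.2 (lt_of_le_of_lt hx hy))⟩
  have hAmem : sSup A ∈ A :=
    (isClosed_le (continuous_absCdf h) continuous_const).csSup_mem ⟨c, hc.le⟩ hAbdd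
  have hAval : absCdf ν (sSup A) = p :=
    le_antisymm hAmem (hc ▸ monotone_absCdf (le_csSup hAbdd hc.le))
  have hiff : ∀ x, absCdf ν x ≤ p ↔ x ≤ sSup A := fun x =>
    ⟨fun hx => le_csSup hAbdd hx, fun hx => (monotone_absCdf hx).trans_eq hAval⟩
  have hset : {e | t < -Real.log (1 - absCdf ν |e|)} = {e : ℝ | |e| ≤ sSup A}ᶜ := by
    ext e
    have hS := sub_pos.2 (hF1 |e|)
    rw [Set.mem_compl_iff, Set.mem_ofPred_eq, Set.mem_ofPred_eq, ← hiff, not_le, hp, lt_neg,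
      Real.log_lt_iff_lt_exp hS]
    constructor <;> intro <;> linarith
  have hmeas : MeasurableSet {e : ℝ | |e| ≤ sSup A} :=
    measurableSet_le measurable_norm measurable_const
  rw [hset, probReal_compl_eq_one_sub hmeas, real_abs_le_eq_absCdf, hAval, hp]
  ring

lemma absCdf_maxCenter (h : Continuous (cdf ν)) {n : ℕ} (hn : 2 ≤ n) :
    absCdf ν (maxCenter (absCdf ν) n) = 1 - 1 / n := by
  have hn' : (2 : ℝ) ≤ n := by exact_mod_cast hn
  have hp0 : 0 < 1 - 1 / (n : ℝ) := by
    rw [sub_pos, div_lt_one (by linarith)]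
    linarith
  obtain ⟨c, hc⟩ := exists_absCdf_eq h hp0.le
    (show 1 - 1 / (n : ℝ) < 1 by linarith [one_div_pos.2 (show (0 : ℝ) < n by linarith)])
  have hbdd : BddBelow {x : ℝ | 1 - 1 / (n : ℝ) ≤ absCdf ν x} := ⟨0, fun x hx => by
    by_contra hx0
    have : 1 - 1 / (n : ℝ) ≤ absCdf ν x := hx
    rw [absCdf_of_neg (not_le.1 hx0)] at this
    linarith⟩
  refine le_antisymm ?_ ?_
  · rw [← hc]
    exact monotone_absCdf (csInf_le hbdd hc.ge)
  · exact (isClosed_le continuous_const (continuous_absCdf h)).csInf_mem ⟨c, hc.ge⟩ hbdd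

lemma tendsto_maxCenter (h : Continuous (cdf ν)) (hF1 : ∀ x, absCdf ν x < 1) :
    Tendsto (maxCenter (absCdf ν)) atTop atTop := by
  refine tendsto_atTop.2 fun M => ?_
  have h1 : Tendsto (fun n : ℕ => 1 - 1 / (n : ℝ)) atTop (𝓝 1) := by
    simpa using tendsto_one_div_atTop_nhds_zero_nat.const_sub (1 : ℝ)
  filter_upwards [h1.eventually (lt_mem_nhds (hF1 M)), eventually_ge_atTop 2] with n hn hn2
  rw [← absCdf_maxCenter h hn2] at hn
  exact (monotone_absCdf.reflect_lt hn).le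

/-- Separation in the extreme value scale makes exceedances by any of `n` errors unlikely. -/
lemma tendsto_mul_survival (h : Continuous (cdf ν)) (hF1 : ∀ x, absCdf ν x < 1)
    (hvm : VonMisesGumbel (absCdf ν) ∨ VonMisesFrechet (absCdf ν)) {x : ℕ → ℝ}
    (hx : Tendsto (fun n => (x n - maxCenter (absCdf ν) n) / maxScale (absCdf ν) n)
      atTop atTop) :
    Tendsto (fun n : ℕ => (n : ℝ) * (1 - absCdf ν (x n))) atTop (𝓝 0) := by
  obtain ⟨x₀, C, hC, hdiff, hpos, hgrow⟩ := exists_reciprocal_hazard_le hF1 hvm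
  have hlim : Tendsto (fun n => Real.exp (-(1 / C) * Real.log
      (1 + (x n - maxCenter (absCdf ν) n) / maxScale (absCdf ν) n))) atTop (𝓝 0) := by
    refine Real.tendsto_exp_atBot.comp ?_
    exact (Real.tendsto_log_atTop.comp (tendsto_atTop_add_const_left _ 1 hx)).const_mul_atTop_of_neg
      (by simpa using hC)
  refine tendsto_of_tendsto_of_tendsto_of_le_of_le' tendsto_const_nhds hlim ?_ ?_
  · exact Eventually.of_forall fun n => mul_nonneg n.cast_nonneg (sub_nonneg.2 (hF1 _).le)
  · filter_upwards [eventually_ge_atTop 2, hx.eventually_ge_atTop 0,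
      (tendsto_maxCenter h hF1).eventually_ge_atTop x₀] with n hn hn0 hnb
    set b := maxCenter (absCdf ν) n with hb
    have hn' : (0 : ℝ) < n := by exact_mod_cast (by omega : 0 < n)
    have hS : 1 - absCdf ν b = 1 / n := by
      rw [hb, absCdf_maxCenter h hn]
      ring
    have hD := hpos b hnb
    -- The normalizing scale is the reciprocal hazard at `b`, because the survival function there
    -- equals `1 / n`.
    have hscale : maxScale (absCdf ν) n = (1 - absCdf ν b) / deriv (absCdf ν) b := by
      rw [hS, maxScale, ← hb]
      field_simp
    have hscale_pos : 0 < maxScale (absCdf ν) n := by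
      rw [hscale, hS]
      positivity
    have hbx : b ≤ x n := by
      have := mul_nonneg hn0 hscale_pos.le
      rw [div_mul_cancel₀ _ hscale_pos.ne'] at this
      linarith
    have key := log_survival_sub_le hF1 hC hdiff hpos hgrow hnb hbx
    rw [← hscale] at key
    refine le_trans (le_of_eq ?_) (Real.exp_le_exp.2 key)
    rw [Real.exp_sub, Real.exp_log (sub_pos.2 (hF1 _)), Real.exp_log (sub_pos.2 (hF1 _)), hS]
    field_simp

end absCdf

/-! ### Deterministic bounds on the statistic. -/

section windowEta

variable {n : ℕ}

/-- The statistic `η_k` in terms of the ordered transformed values. -/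
noncomputable def windowEta (s : Fin n → ℝ) (k : ℕ) : ℝ :=
  ⨆ j : Fin (n - k), |windowSum s k (j.val + 1)
    - windowSum s k (n - k) * nullSlope (n - k) (j.val + 1)| / √((n - k : ℕ) : ℝ)

lemma rtEta_eq_windowEta {F : ℝ → ℝ} {y : Fin n → ℝ} (hs : ∀ i, 0 ≤ ordX F y i) {k : ℕ}
    (hk : k < n) : rtEta F y k = windowEta (ordX F y) k := by
  unfold rtEta windowEta rtQ rtT
  congr 1
  funext j
  rw [nullCondMean_eq (by omega) (by omega) (windowSum_nonneg hs _ _)]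

lemma le_windowEta (s : Fin n → ℝ) {k j : ℕ} (hj : 0 < j) (hjn : j ≤ n - k) :
    |windowSum s k j - windowSum s k (n - k) * nullSlope (n - k) j| / √((n - k : ℕ) : ℝ)
      ≤ windowEta s k := by
  have h := le_ciSup (f := fun j : Fin (n - k) => |windowSum s k (j.val + 1)
    - windowSum s k (n - k) * nullSlope (n - k) (j.val + 1)| / √((n - k : ℕ) : ℝ))
    (Set.finite_range _).bddAbove ⟨j - 1, by omega⟩
  simp only [Nat.sub_add_cancel hj] at h
  exact h

lemma lt_windowEta {s : Fin n → ℝ} {k j : ℕ} {B : ℝ} (hB : 0 ≤ B) (hj : 0 < j) (hjn : j ≤ n - k)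
    (h : B * √n < |windowSum s k j - windowSum s k (n - k) * nullSlope (n - k) j|) :
    B < windowEta s k := by
  refine lt_of_lt_of_le ?_ (le_windowEta s hj hjn)
  have hpos : (0 : ℝ) < ((n - k : ℕ) : ℝ) := by exact_mod_cast (by omega : 0 < n - k)
  rw [lt_div_iff₀ (Real.sqrt_pos.2 hpos)]
  refine lt_of_le_of_lt ?_ h
  gcongr
  exact Nat.sub_le n k

variable {s : Fin n → ℝ} {K : ℕ}

lemma abs_windowSum_full_sub_le (hs : Antitone s) (hs0 : ∀ i, 0 ≤ s i) (hK : K < n) :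
    |windowSum s K (n - K) - ((n - K : ℕ) : ℝ)|
      ≤ tailDev (Finset.univ.filter (fun i : Fin n => K ≤ i.val)) s := by
  have hpos : (0 : ℝ) < ((n - K : ℕ) : ℝ) := by exact_mod_cast (by omega : 0 < n - K)
  have h := abs_windowSum_sub_topMean_le hs hs0 (k := K) (j := n - K) (by omega)
  rwa [div_self hpos.ne', topMean_one, mul_one] at h

/-- At the true number of signals the statistic is controlled by `tailDev`. -/
lemma windowEta_le (hs : Antitone s) (hs0 : ∀ i, 0 ≤ s i) (hK : K < n) {ρ : ℝ}
    (hR : tailDev (Finset.univ.filter (fun i : Fin n => K ≤ i.val)) s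
      ≤ ρ * √((n - K : ℕ) : ℝ)) :
    windowEta s K ≤ 2 * ρ + 2 := by
  have hpos : (0 : ℝ) < ((n - K : ℕ) : ℝ) := by exact_mod_cast (by omega : 0 < n - K)
  have : Nonempty (Fin (n - K)) := ⟨⟨0, by omega⟩⟩
  refine ciSup_le fun j => ?_
  have hj : j.val + 1 ≤ n - K := j.isLt
  have h1 := abs_windowSum_sub_topMean_le hs hs0 (k := K) (j := j.val + 1) (by omega)
  have h2 := abs_windowSum_full_sub_le hs hs0 hK
  have h3 := abs_nullSlope_sub_topMean_le (by omega : 0 < n - K) hj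
  have c0 := nullSlope_nonneg (n - K) (j.val + 1)
  have c1 := nullSlope_le_one hj
  set N : ℝ := ((n - K : ℕ) : ℝ)
  set R := tailDev (Finset.univ.filter (fun i : Fin n => K ≤ i.val)) s
  set c := nullSlope (n - K) (j.val + 1)
  set w := topMean (((j.val + 1 : ℕ) : ℝ) / N)
  set T := windowSum s K (j.val + 1)
  set S := windowSum s K (n - K)
  have hsq : 0 < √N := Real.sqrt_pos.2 hpos
  have hR0 : 0 ≤ R := (abs_nonneg _).trans h1
  rw [div_le_iff₀ hsq]
  -- Three errors: the partial sum against its exponential mean, the total against `N`, and the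
  -- slope against its limit. The first two are at most `R`, the last at most `2 * √N`.
  have h4 : T - S * c = (T - N * w) - c * (S - N) - N * (c - w) := by ring
  have h5 : |N * (c - w)| ≤ 2 * √N := by
    rw [abs_mul, abs_of_pos hpos]
    calc N * |c - w| ≤ N * (2 / √N) := by gcongr
      _ = 2 * (N / √N) := by ring
      _ = 2 * √N := by rw [Real.div_sqrt]
  have h6 : |c * (S - N)| ≤ R := by
    rw [abs_mul, abs_of_nonneg c0]
    calc c * |S - N| ≤ 1 * R := by gcongr
      _ = R := one_mul R
  rw [h4]
  calc |(T - N * w) - c * (S - N) - N * (c - w)|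
      ≤ |T - N * w| + |c * (S - N)| + |N * (c - w)| :=
        (abs_sub _ _).trans (add_le_add_left (abs_sub _ _) _)
    _ ≤ (2 * ρ + 2) * √N := by linarith

/-- If the window starts strictly before the last signal, the statistic is large. -/
lemma lt_windowEta_of_lt (hs : Antitone s) (hs0 : ∀ i, 0 ≤ s i)
    {k : ℕ} {t v B : ℝ} (ht1 : t < 1) (hB : 0 ≤ B)
    (hK : K < n) (hk : k < K) (hKt : (K : ℝ) ≤ t * n)
    (hL : ∀ i : Fin n, i.val < K → Real.log n ≤ s i)
    (hR : tailDev (Finset.univ.filter (fun i : Fin n => K ≤ i.val)) s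
      ≤ ((n - K : ℕ) : ℝ) / 2)
    (hN1 : 2 / √((n - K : ℕ) : ℝ) ≤ 1 / 16)
    (hN2 : 2 / √((n - K : ℕ) : ℝ) ≤ (1 - topMean t) / 2)
    (hlog : 1 ≤ Real.log n)
    (hlog2 : 5 / 2 * (32 * Real.log 32) ≤ (1 - topMean t) / 2 * Real.log n)
    (hBN : B * √n < ((n - K : ℕ) : ℝ)) (hBv : B + 9 / 2 < v / 16)
    (hd : v * √n / 2 ≤ (K : ℝ) - k) :
    B < windowEta s k := by
  obtain ⟨d, rfl⟩ : ∃ d, K = k + d := Nat.exists_eq_add_of_le hk.le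
  -- The test length is `d`, so the partial sum contains exactly the signals left in the window.
  refine lt_windowEta hB (by omega : 0 < d) (by omega) ?_
  have hsplit : windowSum s k (n - k)
      = windowSum s k d + windowSum s (k + d) (n - (k + d)) := by
    rw [← windowSum_add]
    congr 1
    omega
  have hT := mul_le_windowSum (s := s) (k := k) (j := d) (by omega) fun i hi => hL i hi
  have hS := (abs_le.1 (abs_windowSum_full_sub_le hs hs0 hK)).2
  have hS0 : 0 ≤ windowSum s (k + d) (n - (k + d)) := windowSum_nonneg hs0 _ _
  have hc := (abs_le.1 (abs_nullSlope_sub_topMean_le (by omega : 0 < n - k)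
    (by omega : d ≤ n - k))).2
  have c0 := nullSlope_nonneg (n - k) d
  have c1 := nullSlope_le_one (by omega : d ≤ n - k)
  have hmN : (((n - (k + d) : ℕ) : ℕ) : ℝ) ≤ ((n - k : ℕ) : ℝ) := by
    exact_mod_cast (by omega : n - (k + d) ≤ n - k)
  have hmn : ((n - k : ℕ) : ℝ) ≤ n := by exact_mod_cast Nat.sub_le n k
  have hNpos : (0 : ℝ) < ((n - (k + d) : ℕ) : ℝ) := by
    exact_mod_cast (by omega : 0 < n - (k + d))
  have hdt : (d : ℝ) ≤ t * ((n - k : ℕ) : ℝ) := by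
    rw [Nat.cast_sub (by omega)]
    push_cast at hKt
    nlinarith [(Nat.cast_nonneg k : (0 : ℝ) ≤ k)]
  push_cast at hd
  rw [hsplit]
  set T := windowSum s k d
  set S := windowSum s (k + d) (n - (k + d))
  set c := nullSlope (n - k) d
  set N : ℝ := ((n - (k + d) : ℕ) : ℝ)
  set m : ℝ := ((n - k : ℕ) : ℝ)
  set ℓ := Real.log n
  have hmpos : 0 < m := hNpos.trans_le hmN
  have hnpos : (0 : ℝ) < n := hmpos.trans_le hmn
  have hd0 : (0 : ℝ) ≤ d := Nat.cast_nonneg d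
  have hr0 : 0 ≤ (d : ℝ) / m := by positivity
  have hrt : (d : ℝ) / m ≤ t := (div_le_iff₀ hmpos).2 hdt
  have hmr : m * ((d : ℝ) / m) = d := by field_simp
  have hinv : 2 / √m ≤ 2 / √N := by gcongr
  have hsqn : 0 < √(n : ℝ) := Real.sqrt_pos.2 hnpos
  have hSm : S ≤ 3 / 2 * m := by linarith
  have hlow : (1 - c) * (d * ℓ) - c * (3 / 2 * m) ≤ |T - (T + S) * c| := by
    refine le_trans ?_ (le_abs_self _)
    have e1 : (1 - c) * (d * ℓ) ≤ (1 - c) * T :=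
      mul_le_mul_of_nonneg_left hT (by linarith)
    have e2 : c * S ≤ c * (3 / 2 * m) := mul_le_mul_of_nonneg_left hSm c0
    linarith
  refine lt_of_lt_of_le ?_ hlow
  -- With few signals left, the null share of the noise must be compared with `d * ℓ` itself;
  -- otherwise `d` is a fixed fraction of `m` and the growth of `ℓ` suffices.
  by_cases hcase : topMean (d / m) ≤ 1 / 16
  · have hc8 : c ≤ 1 / 8 := by linarith
    -- The level `ℓ / 2` balances the bound: `c * m ≤ d * ℓ / 2 + 3 * √n`. After the factor `3 / 2`
    -- there remains `d * ℓ / 8` from the signals, and `9 / 2 * √n` is lost.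
    have hw := mul_le_mul_of_nonneg_left (topMean_le hr0 (ℓ / 2)) hmpos.le
    have hexp : Real.exp (-(ℓ / 2)) = 1 / √n := by
      rw [Real.exp_neg, ← Real.log_sqrt hnpos.le, Real.exp_log hsqn, one_div]
    rw [mul_add, ← mul_assoc, hmr, hexp] at hw
    have hm1 : m * (1 / √n) ≤ √n := by
      rw [mul_one_div, div_le_iff₀ hsqn, Real.mul_self_sqrt hnpos.le]
      exact hmn
    have hm2 : m * (2 / √m) ≤ 2 * √n := by
      have : m * (2 / √m) = 2 * √m := by
        rw [mul_div_left_comm, Real.div_sqrt]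
      rw [this]
      gcongr
    have hcm : c * m ≤ m * topMean (d / m) + m * (2 / √m) := by
      rw [← mul_add, mul_comm c m]
      exact mul_le_mul_of_nonneg_left (by linarith) hmpos.le
    have hdl : 0 ≤ d * ℓ := mul_nonneg hd0 (by linarith)
    have e1 : 7 / 8 * (d * ℓ) ≤ (1 - c) * (d * ℓ) :=
      mul_le_mul_of_nonneg_right (by linarith) hdl
    have hd2 : v * √n / 2 ≤ d * ℓ := by
      have := mul_le_mul_of_nonneg_left hlog hd0
      linarith
    have e3 : (B + 9 / 2) * √n < v / 16 * √n := mul_lt_mul_of_pos_right hBv hsqn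
    linarith
  · have hlog32 : 0 < Real.log 32 := Real.log_pos (by norm_num)
    -- At this level the exponential term is half of the threshold `1 / 16`, leaving `1 / 32` for `d
    -- / m * log 32`.
    have hw := topMean_le hr0 (Real.log 32)
    have hexp : Real.exp (-Real.log 32) = 1 / 32 := by
      rw [Real.exp_neg, Real.exp_log (by norm_num), one_div]
    rw [hexp] at hw
    have hr : 1 / 32 ≤ d / m * Real.log 32 := by linarith
    have hmd : m ≤ d * (32 * Real.log 32) := by
      have := mul_le_mul_of_nonneg_left hr hmpos.le
      rw [← mul_assoc, hmr] at this
      linarith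
    have hq : c ≤ 1 - (1 - topMean t) / 2 := by
      have := topMean_mono hr0 hrt ht1.le
      linarith
    set q := (1 - topMean t) / 2
    have e1 : q * (d * ℓ) ≤ (1 - c) * (d * ℓ) :=
      mul_le_mul_of_nonneg_right (by linarith) (mul_nonneg hd0 (by linarith))
    have e2 : c * (3 / 2 * m) ≤ 1 * (3 / 2 * m) :=
      mul_le_mul_of_nonneg_right c1 (by positivity)
    have e3 : d * (5 / 2 * (32 * Real.log 32)) ≤ d * (q * ℓ) :=
      mul_le_mul_of_nonneg_left hlog2 hd0
    linarith

/-- If the window starts too late, the statistic is large. -/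
lemma lt_windowEta_of_gt (hs : Antitone s) (hs0 : ∀ i, 0 ≤ s i)
    {k : ℕ} {c v ρ B : ℝ} (hc : 0 < c) (hB : 0 ≤ B)
    (hk : K < k) (hkn : k + 2 ≤ n) (hkc : c * n / 2 ≤ ((n - k : ℕ) : ℝ))
    (hR : tailDev (Finset.univ.filter (fun i : Fin n => K ≤ i.val)) s ≤ ρ * √n)
    (hρ : ρ ≤ √n)
    (hBv : B + 4 * ρ + 4 * √(2 / c) < v * c ^ 2 / 1024)
    (hd : v * √n / 2 ≤ (k : ℝ) - K) :
    B < windowEta s k := by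
  obtain ⟨d, rfl⟩ : ∃ d, k = K + d := Nat.exists_eq_add_of_le hk.le
  have hKn : K < n := by omega
  -- The upper half, rounded up. Since at least two values remain, `j / m` lies in `[1 / 2, 3 / 4]`,
  -- the range where the Lorenz gap is available.
  set j := (n - (K + d) + 1) / 2 with hj
  refine lt_windowEta hB (by omega : 0 < j) (by omega) ?_
  have hc2 := (abs_le.1 (abs_nullSlope_sub_topMean_le (by omega : 0 < n - (K + d))
    (by omega : j ≤ n - (K + d)))).1
  have hTj : windowSum s (K + d) j = windowSum s K (d + j) - windowSum s K d := by
    rw [windowSum_add]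
    ring
  have hTm : windowSum s (K + d) (n - (K + d)) = windowSum s K (n - K) - windowSum s K d := by
    rw [show n - K = d + (n - (K + d)) by omega, windowSum_add]
    ring
  have hTm0 : 0 ≤ windowSum s (K + d) (n - (K + d)) := windowSum_nonneg hs0 _ _
  have hSd0 : 0 ≤ windowSum s K d := windowSum_nonneg hs0 _ _
  have hS1 := (abs_le.1 (abs_windowSum_sub_topMean_le hs hs0 (k := K) (j := d + j) (by omega))).2
  have hS2 := abs_le.1 (abs_windowSum_sub_topMean_le hs hs0 (k := K) (j := d) (by omega))
  have hS3 := abs_le.1 (abs_windowSum_full_sub_le hs hs0 hKn)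
  have hNd : ((n - K : ℕ) : ℝ) = d + ((n - (K + d) : ℕ) : ℝ) := by
    exact_mod_cast (by omega : n - K = d + (n - (K + d)))
  have hNn : ((n - K : ℕ) : ℝ) ≤ n := by exact_mod_cast Nat.sub_le n K
  have hmn : ((n - (K + d) : ℕ) : ℝ) ≤ n := by exact_mod_cast Nat.sub_le n (K + d)
  have hm2 : (2 : ℝ) ≤ ((n - (K + d) : ℕ) : ℝ) := by exact_mod_cast (by omega : 2 ≤ n - (K + d))
  have hj1 : ((n - (K + d) : ℕ) : ℝ) ≤ 2 * (j : ℝ) := by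
    exact_mod_cast (by omega : n - (K + d) ≤ 2 * j)
  have hj2 : 4 * (j : ℝ) ≤ 3 * ((n - (K + d) : ℕ) : ℝ) := by
    exact_mod_cast (by omega : 4 * j ≤ 3 * (n - (K + d)))
  have hdpos : (0 : ℝ) < d := by exact_mod_cast (by omega : 0 < d)
  push_cast at hd hS1
  set R := tailDev (Finset.univ.filter (fun i : Fin n => K ≤ i.val)) s
  set c' := nullSlope (n - (K + d)) j
  set Tj := windowSum s (K + d) j
  set Tm := windowSum s (K + d) (n - (K + d))
  set N : ℝ := ((n - K : ℕ) : ℝ)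
  set m : ℝ := ((n - (K + d) : ℕ) : ℝ)
  have hmpos : 0 < m := by linarith
  have hNpos : 0 < N := by linarith
  have hnpos : (0 : ℝ) < n := by linarith
  have hsqn : 0 < √(n : ℝ) := Real.sqrt_pos.2 hnpos
  have hR0 : 0 ≤ R := tailDev_nonneg _ _
  -- Here `a` is the fraction of nulls kept after dropping the top `d`, and `r` is the fraction of
  -- those that is summed. The right side is then the null prediction minus the limiting partial
  -- sum, per null observation.
  have hgap := topMean_gap (a := m / N) (r := j / m) (by positivity)
    ((div_lt_one hNpos).2 (by linarith)) (by rw [le_div_iff₀ hmpos]; linarith)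
    (by rw [div_le_iff₀ hmpos]; linarith)
  have ha1 : 1 - m / N = d / N := by
    rw [eq_div_iff hNpos.ne', sub_mul, div_mul_cancel₀ _ hNpos.ne']
    linarith
  have ha2 : 1 - m / N * (1 - j / m) = (d + j) / N := by
    have : m / N * (1 - j / m) = (m - j) / N := by field_simp
    rw [this, eq_div_iff hNpos.ne', sub_mul, div_mul_cancel₀ _ hNpos.ne']
    linarith
  rw [ha2, ha1] at hgap
  have hgap2 := mul_le_mul_of_nonneg_left hgap hNpos.le
  have hleft : N * ((m / N) ^ 2 * (d / N) / 128) = (m / N) ^ 2 * d / 128 := by field_simp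
  rw [hleft] at hgap2
  set w := topMean (j / m)
  set w₁ := topMean (d / N)
  set w₂ := topMean ((d + j) / N)
  have hw0 : 0 ≤ w := topMean_nonneg (by positivity) (by rw [div_le_one hmpos]; linarith)
  have hw1 : w ≤ 1 := topMean_le_one (by positivity)
  have hRn : R ≤ n := hR.trans (by
    calc ρ * √n ≤ √n * √n := by gcongr
      _ = n := Real.mul_self_sqrt hnpos.le)
  have e1 : (w - 2 / √m) * Tm ≤ c' * Tm := mul_le_mul_of_nonneg_right (by linarith) hTm0
  have e2 : w * (N - N * w₁ - 2 * R) ≤ w * Tm := mul_le_mul_of_nonneg_left (by linarith) hw0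
  have e3 : w * (2 * R) ≤ 1 * (2 * R) := mul_le_mul_of_nonneg_right hw1 (by linarith)
  have hsqm : n / √m ≤ √(2 / c) * √n := by
    rw [div_le_iff₀ (Real.sqrt_pos.2 hmpos)]
    have : √(n : ℝ) ≤ √(2 / c) * √m := by
      rw [← Real.sqrt_mul (by positivity)]
      refine Real.sqrt_le_sqrt ?_
      rw [div_mul_eq_mul_div, le_div_iff₀ hc]
      linarith
    calc (n : ℝ) = √n * √n := (Real.mul_self_sqrt hnpos.le).symm
      _ ≤ √n * (√(2 / c) * √m) := by gcongr
      _ = √(2 / c) * √n * √m := by ring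
  have e4 : 2 / √m * Tm ≤ 4 * (√(2 / c) * √n) := by
    calc 2 / √m * Tm ≤ 2 / √m * (2 * n) := by
          gcongr
          linarith
      _ = 4 * (n / √m) := by ring
      _ ≤ 4 * (√(2 / c) * √n) := by gcongr
  have ha : c / 2 ≤ m / N := by
    rw [le_div_iff₀ hNpos]
    have := mul_le_mul_of_nonneg_left hNn hc.le
    linarith
  have e5 : v * c ^ 2 / 1024 * √n ≤ (m / N) ^ 2 * d / 128 := by
    have h1 : (c / 2) ^ 2 ≤ (m / N) ^ 2 := by gcongr
    have h2 := mul_le_mul_of_nonneg_right h1 hdpos.le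
    have h3 := mul_le_mul_of_nonneg_left hd (by positivity : (0 : ℝ) ≤ c ^ 2)
    linarith
  have e6 := mul_lt_mul_of_pos_right hBv hsqn
  -- Starting late makes the partial sum too small, so the sign is reversed. The losses are `4 * R`
  -- from four uses of `tailDev` and `4 * √(2 / c) * √n` from the slope.
  rw [← neg_sub, abs_neg]
  refine lt_of_lt_of_le ?_ (le_abs_self _)
  linarith

end windowEta

/-! ### The good event and its probability. -/

section consistency

variable {ν : Measure ℝ} {n : ℕ}

/-- The transformed absolute value, standard exponential under `ν`. -/
noncomputable def expTransform (ν : Measure ℝ) (e : ℝ) : ℝ := -Real.log (1 - absCdf ν |e|)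

lemma measurable_expTransform : Measurable (expTransform ν) := by
  have h : Measurable (absCdf ν) := monotone_absCdf.measurable
  exact (Real.measurable_log.comp (measurable_const.sub (h.comp measurable_norm))).neg

lemma neg_log_survival_mono (hF1 : ∀ x, absCdf ν x < 1) :
    Monotone fun x => -Real.log (1 - absCdf ν x) := by
  intro x y hxy
  have h1 := monotone_absCdf (ν := ν) hxy
  have h2 := sub_pos.2 (hF1 y)
  exact neg_le_neg (Real.log_le_log h2 (by linarith))

lemma ordX_nonneg (hF1 : ∀ x, absCdf ν x < 1) (y : Fin n → ℝ) (i : Fin n) :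
    0 ≤ ordX (absCdf ν) y i :=
  neg_nonneg.2 (Real.log_nonpos (sub_nonneg.2 (hF1 _).le)
    (by linarith [absCdf_nonneg (ν := ν) (decr (fun l => |y l|) i)]))

lemma antitone_ordX (hF1 : ∀ x, absCdf ν x < 1) (y : Fin n → ℝ) :
    Antitone (ordX (absCdf ν) y) :=
  (neg_log_survival_mono hF1).comp_antitone (antitone_decr _)

/-- On the event that the signals are separated from the noise and that the noise has moderate
`tailDev`, every minimizer is close to the fraction of signals. -/
lemma abs_div_sub_le_of_isRTEstimate (hF1 : ∀ x, absCdf ν x < 1)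
    {I : Finset (Fin n)} {μ e : Fin n → ℝ} {t c u v ρ α : ℝ} {κ k : ℕ}
    (hc : 0 < c) (ht0 : 0 ≤ t) (ht1 : t < 1) (hn : 0 < n) (hcard : I.card = ⌊t * n⌋₊)
    (hμ_zero : ∀ i ∉ I, μ i = 0) (hμ_ge : ∀ i ∈ I, α ≤ |μ i|)
    (he : ∀ i, |e i| < α / 2)
    (hR : tailDev Iᶜ (fun i => expTransform ν (e i)) ≤ ρ * √((n - I.card : ℕ) : ℝ))
    (hα : (n : ℝ) * (1 - absCdf ν (α / 2)) ≤ 1)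
    (hest : IsRTEstimate (absCdf ν) κ (fun i => μ i + e i) k)
    (hK1 : 1 ≤ I.card) (hKκ : I.card + κ ≤ n) (hκ2 : 2 ≤ κ) (hκc : c * n / 2 ≤ κ)
    (hρ : 0 ≤ ρ) (hρn : ρ ≤ √n) (hρN : ρ * 2 ≤ √((n - I.card : ℕ) : ℝ))
    (hN1 : 2 / √((n - I.card : ℕ) : ℝ) ≤ 1 / 16)
    (hN2 : 2 / √((n - I.card : ℕ) : ℝ) ≤ (1 - topMean t) / 2)
    (hlog : 1 ≤ Real.log n)
    (hlog2 : 5 / 2 * (32 * Real.log 32) ≤ (1 - topMean t) / 2 * Real.log n)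
    (hBN : (2 * ρ + 2) * √n < ((n - I.card : ℕ) : ℝ))
    (hv : v * √n = n * u) (hv2 : 2 ≤ n * u)
    (hBv : (2 * ρ + 2) + 9 / 2 < v / 16)
    (hBv2 : (2 * ρ + 2) + 4 * ρ + 4 * √(2 / c) < v * c ^ 2 / 1024) :
    |(k : ℝ) / n - t| ≤ u := by
  set K := I.card with hK
  set y : Fin n → ℝ := fun i => μ i + e i with hy
  set s := ordX (absCdf ν) y with hs
  set σ := Tuple.sort (fun l => -|y l|) with hσ
  have hn' : (0 : ℝ) < n := by exact_mod_cast hn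
  have hsσ : ∀ i, s i = expTransform ν (y (σ i)) := fun i => rfl
  have hyI : ∀ i ∈ I, α / 2 < |y i| := by
    intro i hi
    have h1 := abs_sub_abs_le_abs_sub (μ i) (-e i)
    rw [sub_neg_eq_add, abs_neg] at h1
    have := hμ_ge i hi
    have := he i
    change α / 2 < |μ i + e i|
    linarith
  have hyIc : ∀ i ∉ I, y i = e i := fun i hi => by simp [hy, hμ_zero i hi]
  have hmap := map_sort_filter_eq_compl (y := fun i => |y i|) hyI
    (fun i hi => by
      rw [hyIc i hi]
      exact he i)
  have hdev : tailDev (Finset.univ.filter (fun i : Fin n => K ≤ i.val)) s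
      ≤ ρ * √((n - K : ℕ) : ℝ) := by
    have h1 := tailDev_comp_equiv (Finset.univ.filter (fun i : Fin n => K ≤ i.val)) σ
      (fun i => expTransform ν (y i))
    rw [hmap] at h1
    change tailDev _ (fun i => expTransform ν (y (σ i))) ≤ _
    rw [h1, tailDev_congr Iᶜ (x' := fun i => expTransform ν (e i)) fun i hi => by
      rw [hyIc i (Finset.mem_compl.1 hi)]]
    exact hR
  have hL : ∀ i : Fin n, i.val < K → Real.log n ≤ s i := by
    intro i hi
    have hiI : σ i ∈ I := by
      by_contra hcon
      have h1 : σ i ∈ Iᶜ := Finset.mem_compl.2 hcon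
      rw [← hmap, Finset.mem_map_equiv] at h1
      change σ.symm (σ i) ∈ _ at h1
      rw [Equiv.symm_apply_apply, Finset.mem_filter] at h1
      omega
    have hS := sub_pos.2 (hF1 (α / 2))
    -- A survival probability of at most `1 / n` at `α / 2` is, in the exponential scale, a value of
    -- at least `log n`.
    have h2 : Real.log n ≤ -Real.log (1 - absCdf ν (α / 2)) := by
      have := Real.log_nonpos (mul_nonneg hn'.le hS.le) hα
      rw [Real.log_mul hn'.ne' hS.ne'] at this
      linarith
    exact h2.trans (neg_log_survival_mono hF1 (hyI _ hiI).le)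
  have hs0 : ∀ i, 0 ≤ s i := ordX_nonneg hF1 y
  have hsa : Antitone s := antitone_ordX hF1 y
  have hKn : K < n := by omega
  obtain ⟨⟨hk1, hkκ⟩, hmin⟩ := hest
  have hkn : k < n := by omega
  have hle : windowEta s k ≤ 2 * ρ + 2 := by
    have h1 := hmin K hK1 hKκ
    rw [rtEta_eq_windowEta hs0 hkn, rtEta_eq_windowEta hs0 hKn] at h1
    exact h1.trans (windowEta_le hsa hs0 hKn hdev)
  have hKt : (K : ℝ) ≤ t * n := by
    rw [hcard]
    exact Nat.floor_le (by positivity)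
  have hKt2 : t * n < K + 1 := by
    rw [hcard]
    exact Nat.lt_floor_add_one _
  have hNn : ((n - K : ℕ) : ℝ) ≤ n := by exact_mod_cast Nat.sub_le n K
  by_contra hcon
  rw [not_le] at hcon
  have hcon' : n * u < |(k : ℝ) - t * n| := by
    have h1 : (k : ℝ) - t * n = n * (k / n - t) := by field_simp
    rw [h1, abs_mul, abs_of_pos hn']
    exact mul_lt_mul_of_pos_left hcon hn'
  refine absurd hle (not_le.2 ?_)
  -- Since `K` is the floor of `t * n`, passing to `K` costs less than one when `k` is too small; `2
  -- ≤ n * u` absorbs this, leaving a distance of at least `n * u / 2`.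
  rcases lt_abs.1 hcon' with hgt | hlt
  · have hKk : (K : ℝ) < k := by linarith
    refine lt_windowEta_of_gt hsa hs0 hc (by linarith) (by exact_mod_cast hKk) (by omega)
      (hκc.trans (by exact_mod_cast (by omega : κ ≤ n - k))) (hdev.trans ?_) hρn hBv2
      (by rw [hv]; linarith)
    gcongr
  · have hkK : (k : ℝ) < K := by linarith
    refine lt_windowEta_of_lt hsa hs0 ht1 (by linarith) hKn (by exact_mod_cast hkK) hKt hL
      (hdev.trans ?_) hN1 hN2 hlog hlog2 hBN hBv (by rw [hv]; linarith)
    have h1 := mul_le_mul_of_nonneg_right hρN (Real.sqrt_nonneg ((n - K : ℕ) : ℝ))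
    rw [Real.mul_self_sqrt (Nat.cast_nonneg _)] at h1
    linarith

variable [IsProbabilityMeasure ν]

lemma measure_le_abs_eq (h : Continuous (cdf ν)) (b : ℝ) :
    ν {e | b ≤ |e|} = ENNReal.ofReal (1 - absCdf ν b) := by
  have hae : {e : ℝ | b ≤ |e|} =ᵐ[ν] ({e : ℝ | |e| ≤ b}ᶜ : Set ℝ) := by
    have h1 : ∀ a : ℝ, ∀ᵐ e ∂ν, e ≠ a := fun a => by
      simpa [ae_iff] using measure_singleton_of_continuous_cdf h a
    filter_upwards [h1 b, h1 (-b)] with e he1 he2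
    apply propext
    change b ≤ |e| ↔ ¬ |e| ≤ b
    rw [not_le]
    refine ⟨fun hb => lt_of_le_of_ne hb fun hbe => ?_, le_of_lt⟩
    rcases abs_choice e with h2 | h2 <;> rw [h2] at hbe
    · exact he1 hbe.symm
    · exact he2 (by linarith)
  have hmeas : MeasurableSet {e : ℝ | |e| ≤ b} := measurableSet_le measurable_norm measurable_const
  rw [measure_congr hae, ← ofReal_measureReal (μ := ν), probReal_compl_eq_one_sub hmeas,
    real_abs_le_eq_absCdf]

/-- The errors fail to be separated from the signals, or their `tailDev` is large, only with small
probability. -/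
lemma pi_bad_errors_le (h : Continuous (cdf ν)) (hF1 : ∀ x, absCdf ν x < 1) (T : Finset (Fin n))
    (hT : 0 < T.card) (b : ℝ) {ρ : ℝ} (hρ : 0 < ρ) :
    Measure.pi (fun _ : Fin n => ν) ({e | ∃ i, b ≤ |e i|} ∪
        {e | ρ * √T.card ≤ tailDev T (fun i => expTransform ν (e i))})
      ≤ ENNReal.ofReal (n * (1 - absCdf ν b)) + ENNReal.ofReal (2 / ρ) := by
  refine (measure_union_le _ _).trans (add_le_add ?_ ?_)
  · have h1 : {e : Fin n → ℝ | ∃ i, b ≤ |e i|} = ⋃ i, Function.eval i ⁻¹' {e : ℝ | b ≤ |e|} := by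
      ext e
      simp
    rw [h1]
    refine (measure_iUnion_fintype_le _ _).trans ?_
    have h2 : ∀ i : Fin n, Measure.pi (fun _ : Fin n => ν) (Function.eval i ⁻¹' {e : ℝ | b ≤ |e|})
        = ENNReal.ofReal (1 - absCdf ν b) := fun i => by
      rw [← measure_le_abs_eq h b]
      exact (measurePreserving_eval (fun _ : Fin n => ν) i).measure_preimage
        (measurableSet_le measurable_const measurable_norm).nullMeasurableSet
    simp_rw [h2]
    rw [Finset.sum_const, Finset.card_univ, Fintype.card_fin, nsmul_eq_mul,
      ENNReal.ofReal_mul (Nat.cast_nonneg n), ENNReal.ofReal_natCast]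
  · have hZ : ∀ i ∈ T, Measurable fun e : Fin n → ℝ => expTransform ν (e i) := fun i _ =>
      measurable_expTransform.comp (measurable_pi_apply i)
    have hmean := lintegral_tailDev_le (P := Measure.pi (fun _ : Fin n => ν)) (T := T)
      (Z := fun i e => expTransform ν (e i)) hZ
      (fun i _ j _ hij => (iIndepFun_pi (X := fun _ x => expTransform ν x)
        (μ := fun _ : Fin n => ν) fun _ => measurable_expTransform.aemeasurable).indepFun hij)
      (fun i _ t ht => by
        rw [← real_lt_neg_log_absCdf h hF1 ht, measureReal_def, measureReal_def]
        congr 1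
        exact (measurePreserving_eval (fun _ : Fin n => ν) i).measure_preimage
          (measurableSet_lt measurable_const measurable_expTransform).nullMeasurableSet)
    have hpos : 0 < ρ * √T.card := mul_pos hρ (Real.sqrt_pos.2 (by exact_mod_cast hT))
    calc Measure.pi (fun _ : Fin n => ν)
          {e | ρ * √T.card ≤ tailDev T (fun i => expTransform ν (e i))}
        ≤ Measure.pi (fun _ : Fin n => ν) {e | ENNReal.ofReal (ρ * √T.card)
            ≤ ENNReal.ofReal (tailDev T (fun i => expTransform ν (e i)))} :=
          measure_mono fun e he => ENNReal.ofReal_le_ofReal he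
      _ ≤ (∫⁻ e, ENNReal.ofReal (tailDev T (fun i => expTransform ν (e i)))
            ∂(Measure.pi (fun _ : Fin n => ν))) / ENNReal.ofReal (ρ * √T.card) :=
          meas_ge_le_lintegral_div (measurable_tailDev hZ).ennreal_ofReal.aemeasurable
            (by simpa using hpos) ENNReal.ofReal_ne_top
      _ ≤ ENNReal.ofReal (2 * √T.card) / ENNReal.ofReal (ρ * √T.card) := by gcongr
      _ = ENNReal.ofReal (2 / ρ) := by
          rw [← ENNReal.ofReal_div_of_pos hpos]
          congr 1
          have : √(T.card : ℝ) ≠ 0 := (Real.sqrt_pos.2 (by exact_mod_cast hT)).ne'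
          field_simp

/-- Used with `x = √v` or `x` the fourth root of `n`: terms linear in `ρ` are then dominated by `v`
or `√n`. -/
lemma eventually_linear_lt_sq (a b : ℝ) {c : ℝ} (hc : 0 < c) :
    ∀ᶠ x : ℝ in atTop, a * x + b < c * x ^ 2 := by
  filter_upwards [eventually_ge_atTop ((a + 1) / c), eventually_gt_atTop b,
    eventually_ge_atTop 0] with x h1 h2 h3
  rw [div_le_iff₀ hc] at h1
  nlinarith

end consistency

/-! ### Choice of the rates and conclusion. -/

theorem theorem2
    -- the law `ν` of the errors: zero mean, continuous cdf
    (ν : Measure ℝ) [IsProbabilityMeasure ν] (hν_cont : Continuous (cdf ν))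
    (hν_int : Integrable (fun e : ℝ => e) ν) (hν_mean : ∫ e, e ∂ν = 0)
    -- von Mises type conditions
    (hF_lt : ∀ x, absCdf ν x < 1)
    (hF_vm : VonMisesGumbel (absCdf ν) ∨ VonMisesFrechet (absCdf ν))
    -- for each `n`, the errors are independent with law `ν`
    {Ω : ℕ → Type*} [∀ n, MeasurableSpace (Ω n)]
    (P : ∀ n, Measure (Ω n)) [∀ n, IsProbabilityMeasure (P n)]
    (ε : ∀ n, Fin n → Ω n → ℝ)
    (hε_law : ∀ n i, HasLaw (ε n i) ν (P n))
    (hε_indep : ∀ n, iIndepFun (ε n) (P n))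
    -- the means: a fraction `tstar` of them is nonzero
    (μ : ∀ n, Fin n → ℝ) (tstar : ℝ) (ht0 : 0 < tstar) (ht1 : tstar < 1)
    (I : ∀ n, Finset (Fin n)) (hI_card : ∀ n, (I n).card = ⌊tstar * (n : ℝ)⌋₊)
    (hμ_ne : ∀ n, ∀ i ∈ I n, μ n i ≠ 0) (hμ_zero : ∀ n, ∀ i ∉ I n, μ n i = 0)
    -- the nonzero means are separated from the errors
    (α : ℕ → ℝ) (hα : Tendsto α atTop atTop)
    (hα_sep : Tendsto
      (fun n => (α n / 2 - maxCenter (absCdf ν) n) / maxScale (absCdf ν) n) atTop atTop)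
    (hμ_ge : ∀ n, ∀ i ∈ I n, α n ≤ |μ n i|)
    -- the lower bound on the number of null coefficients
    (κ : ℕ → ℕ) (c : ℝ) (hc0 : 0 < c) (hc1 : c < 1 - tstar)
    (hκ : Tendsto (fun n => (κ n : ℝ) / (n : ℝ)) atTop (𝓝 c))
    -- the estimator, computed from `Y_i = μ_i + ε_i`
    (khat : ∀ n, Ω n → ℕ)
    (hkhat : ∀ n, κ n < n → ∀ ω,
      IsRTEstimate (absCdf ν) (κ n) (fun i => μ n i + ε n i ω) (khat n ω))
    (u : ℕ → ℝ) (hu_pos : ∀ n, 0 < u n) (hu_anti : Antitone u)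
    (hu : Tendsto (fun n : ℕ => √((n : ℕ) : ℝ) * u n) atTop atTop) :
    Tendsto (fun n => P n {ω | u n < |(khat n ω : ℝ) / (n : ℝ) - tstar|}) atTop (𝓝 0) := by
  set K : ℕ → ℕ := fun n => (I n).card with hK
  set v : ℕ → ℝ := fun n => √(n : ℝ) * u n with hv
  -- The Markov bound `2 / ρ` needs `ρ → ∞`, while the lower bounds on the statistic need `ρ`
  -- negligible against both `v` and `√n`; the minimum of their square roots does both.
  set ρ : ℕ → ℝ := fun n => min (√(v n)) (√√(n : ℝ)) with hρ
  have hnat : Tendsto (fun n : ℕ => (n : ℝ)) atTop atTop := tendsto_natCast_atTop_atTop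
  have hsqrt : Tendsto (fun n : ℕ => √(n : ℝ)) atTop atTop := Real.tendsto_sqrt_atTop.comp hnat
  have hsqrt2 : Tendsto (fun n : ℕ => √√(n : ℝ)) atTop atTop :=
    Real.tendsto_sqrt_atTop.comp hsqrt
  have hsqrtv : Tendsto (fun n : ℕ => √(v n)) atTop atTop := Real.tendsto_sqrt_atTop.comp hu
  have hρ_top : Tendsto ρ atTop atTop := tendsto_atTop.2 fun M => by
    filter_upwards [hsqrtv.eventually_ge_atTop M, hsqrt2.eventually_ge_atTop M] with n h1 h2
    exact le_min h1 h2
  have hsurv := tendsto_mul_survival hν_cont hF_lt hF_vm (x := fun n => α n / 2) hα_sep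
  have hbound : Tendsto (fun n : ℕ =>
      ENNReal.ofReal (n * (1 - absCdf ν (α n / 2))) + ENNReal.ofReal (2 / ρ n)) atTop (𝓝 0) := by
    have h1 := ENNReal.tendsto_ofReal hsurv
    have h2 := ENNReal.tendsto_ofReal (hρ_top.const_div_atTop 2)
    simpa using h1.add h2
  have hNlow : ∀ n : ℕ, (1 - tstar) * n ≤ ((n - K n : ℕ) : ℝ) := by
    intro n
    have h1 : (K n : ℝ) ≤ tstar * n := by
      simp only [hK, hI_card]
      exact Nat.floor_le (by positivity)
    have h2 : (n : ℝ) ≤ ((n - K n : ℕ) : ℝ) + K n := by exact_mod_cast (by omega)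
    linarith
  have ht1' : 0 < 1 - tstar := by linarith
  have hN_top : Tendsto (fun n : ℕ => √((n - K n : ℕ) : ℝ)) atTop atTop :=
    Real.tendsto_sqrt_atTop.comp (tendsto_atTop_mono hNlow (hnat.const_mul_atTop ht1'))
  have hNinv : Tendsto (fun n : ℕ => 2 / √((n - K n : ℕ) : ℝ)) atTop (𝓝 0) :=
    hN_top.const_div_atTop 2
  have hq : 0 < (1 - topMean tstar) / 2 := by
    have := topMean_lt_one ht0.le ht1
    linarith
  have hlog : Tendsto (fun n : ℕ => Real.log n) atTop atTop := Real.tendsto_log_atTop.comp hnat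
  have hc2 : 0 < c ^ 2 / 1024 := by positivity
  refine tendsto_of_tendsto_of_tendsto_of_le_of_le' tendsto_const_nhds hbound
    (Eventually.of_forall fun _ => zero_le) ?_
  have hz : ∀ᶠ n : ℕ in atTop, 2 * √√(n : ℝ) + 2 < (1 - tstar) * √√(n : ℝ) ^ 2 :=
    hsqrt2.eventually (eventually_linear_lt_sq 2 2 ht1')
  have hv1 : ∀ᶠ n : ℕ in atTop, 2 * √(v n) + (2 + 9 / 2) < 1 / 16 * √(v n) ^ 2 :=
    hsqrtv.eventually (eventually_linear_lt_sq 2 _ (by norm_num))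
  have hv2 : ∀ᶠ n : ℕ in atTop, 6 * √(v n) + (2 + 4 * √(2 / c)) < c ^ 2 / 1024 * √(v n) ^ 2 :=
    hsqrtv.eventually (eventually_linear_lt_sq 6 _ hc2)
  filter_upwards [hz, hv1, hv2, hu.eventually_ge_atTop 2, hsqrt.eventually_ge_atTop 1,
    hρ_top.eventually_gt_atTop 0,
    hsqrt2.eventually_ge_atTop (2 / √(1 - tstar)),
    hNinv.eventually_le_const (show (0 : ℝ) < 1 / 16 by norm_num),
    hNinv.eventually_le_const hq, hlog.eventually_ge_atTop 1,
    (hlog.const_mul_atTop hq).eventually_ge_atTop (5 / 2 * (32 * Real.log 32)),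
    hsurv.eventually_le_const one_pos,
    hκ.eventually_lt_const hc1, hκ.eventually_const_le (show c / 2 < c by linarith),
    hnat.eventually_ge_atTop (1 / tstar), hnat.eventually_ge_atTop (4 / c),
    eventually_gt_atTop 0] with n ez ev1 ev2 ev es eρ ez2 eN1 eN2 el1 el2 esv eκ1 eκ2 et ec en
  have hn' : (0 : ℝ) < n := by exact_mod_cast en
  have hsq : √(n : ℝ) * √n = n := Real.mul_self_sqrt hn'.le
  have hsq2 : √√(n : ℝ) ^ 2 = √n := Real.sq_sqrt (Real.sqrt_nonneg _)
  have hvn : √(v n) ^ 2 = v n := Real.sq_sqrt (by linarith)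
  have hρ1 : ρ n ≤ √(v n) := min_le_left _ _
  have hρ2 : ρ n ≤ √√(n : ℝ) := min_le_right _ _
  have hKt : (K n : ℝ) ≤ tstar * n := by
    simp only [hK, hI_card]
    exact Nat.floor_le (by positivity)
  have hK1 : 1 ≤ K n := by
    simp only [hK, hI_card]
    rw [Nat.one_le_floor_iff]
    rw [div_le_iff₀ ht0] at et
    linarith
  rw [div_lt_iff₀ hn'] at eκ1
  rw [le_div_iff₀ hn'] at eκ2
  rw [div_le_iff₀ hc0] at ec
  have hKκ : K n + κ n ≤ n := by
    have : (K n : ℝ) + κ n ≤ n := by linarith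
    exact_mod_cast this
  have hκ2 : 2 ≤ κ n := by
    have : (2 : ℝ) ≤ κ n := by linarith
    exact_mod_cast this
  have hκn : κ n < n := by omega
  have hcardc : ((I n)ᶜ).card = n - K n := by
    rw [Finset.card_compl, Fintype.card_fin]
  have hz_one : 1 ≤ √√(n : ℝ) := Real.one_le_sqrt.2 es
  have hzn : √√(n : ℝ) ≤ √n := by
    calc √√(n : ℝ) = √√(n : ℝ) * 1 := (mul_one _).symm
      _ ≤ √√(n : ℝ) * √√(n : ℝ) := by gcongr
      _ = √n := Real.mul_self_sqrt (Real.sqrt_nonneg _)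
  have hρN : ρ n * 2 ≤ √((n - K n : ℕ) : ℝ) := by
    rw [div_le_iff₀ (Real.sqrt_pos.2 ht1')] at ez2
    calc ρ n * 2 ≤ √√(n : ℝ) * (√√(n : ℝ) * √(1 - tstar)) := by gcongr
      _ = √((1 - tstar) * n) := by
          rw [← mul_assoc, Real.mul_self_sqrt (Real.sqrt_nonneg _),
            Real.sqrt_mul ht1'.le, mul_comm]
      _ ≤ √((n - K n : ℕ) : ℝ) := Real.sqrt_le_sqrt (hNlow n)
  have hBN : (2 * ρ n + 2) * √n < ((n - K n : ℕ) : ℝ) := by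
    refine lt_of_lt_of_le ?_ (hNlow n)
    rw [hsq2] at ez
    calc (2 * ρ n + 2) * √n ≤ (2 * √√(n : ℝ) + 2) * √n := by gcongr
      _ < (1 - tstar) * √n * √n := by gcongr
      _ = (1 - tstar) * n := by rw [mul_assoc, hsq]
  have hvu : v n * √n = n * u n := by
    simp only [hv]
    rw [mul_right_comm, hsq]
  have hnu : 2 ≤ n * u n := by
    rw [← hvu]
    calc (2 : ℝ) = 2 * 1 := (mul_one _).symm
      _ ≤ v n * √n := mul_le_mul ev es zero_le_one (by linarith)
  have hmapε : (P n).map (fun ω i => ε n i ω) = Measure.pi (fun _ : Fin n => ν) := by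
    rw [(hε_indep n).map_fun_eq_pi_map fun i => (hε_law n i).aemeasurable]
    congr 1
    funext i
    exact (hε_law n i).map_eq
  have haem : AEMeasurable (fun ω i => ε n i ω) (P n) :=
    aemeasurable_pi_lambda _ fun i => (hε_law n i).aemeasurable
  have hbad := pi_bad_errors_le hν_cont hF_lt (I n)ᶜ (by omega) (α n / 2) eρ
  rw [← hmapε] at hbad
  -- The estimator need not be measurable: its deviation event is included in the preimage of a bad
  -- set of error vectors, and `Measure.le_map_apply` bounds the outer measure of such a preimage.
  refine le_trans (le_trans (measure_mono ?_) (Measure.le_map_apply haem _)) hbad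
  intro ω hω
  by_contra hgood
  simp only [Set.mem_preimage, Set.mem_union, Set.mem_ofPred_eq, not_or, not_exists, not_le]
    at hgood
  obtain ⟨hg1, hg2⟩ := hgood
  rw [hcardc] at hg2
  rw [hvn] at ev1 ev2
  refine absurd (abs_div_sub_le_of_isRTEstimate hF_lt hc0 ht0.le ht1 en (hI_card n) (hμ_zero n)
    (hμ_ge n) hg1 hg2.le esv (hkhat n hκn ω) hK1 hKκ hκ2 (by linarith) eρ.le
    (hρ2.trans hzn) hρN eN1 eN2 el1 el2 hBN hvu hnu (by linarith) (by linarith)) (not_le.2 hω)
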